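/- Let $n\ge 1$, let $\mathbb F_q$ be a finite field and let $\theta:\mathbb F_q^+\to\mathbb C^\times$ be a nontrivial homomorphism. Write $[[n]]=\{(i,j):1\le i<j\le n\}$. A \emph{poset} on $[n]=\{1,\dots,n\}$ is a subset $\mathcal P\subset[[n]]$ such that $(i,j),(j,k)\in\mathcal P$ implies $(i,k)\in\mathcal P$; its set of covers $\mathcal P^{\mathrm{cov}}$ consists of the $(i,k)\in\mathcal P$ for which there is no $j$ with $(i,j),(j,k)\in\mathcal P$. We write $\mathcal P\vartriangleleft[[n]]$ if $(j,k)\in\mathcal P$ implies $(i,l)\in\mathcal P$ whenever $1\le i\le j<k\le l\le n$. \emph{Supercharacters.} Let $\mathfrak n_{\mathcal P}$ be the $\mathbb F_q$-algebra of $n\times n$ matrices over $\mathbb F_q$ whose nonzero entries all lie in positions of $\mathcal P$, and let $U_{\mathcal P}=1+\mathfrak n_{\mathcal P}$. For $\lambda$ in the dual space $\mathfrak n_{\mathcal P}^*$ put $\lambda_{ij}=\lambda(e_{ij})$ if $(i,j)\in\mathcal P$ and $\lambda_{ij}=0$ otherwise, and $\mathrm{supp}(\lambda)=\{(i,j):\lambda_{ij}\ne0\}$.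 The group $U_{\mathcal P}$ acts on $\mathfrak n_{\mathcal P}^*$ by $(g\lambda)(X)=\lambda(g^{-1}X)$ and $(\lambda g)(X)=\lambda(Xg^{-1})$. The supercharacters of $U_{\mathcal P}$ are the functions $$\chi^\lambda_{\mathcal P}(g)=\frac{|U_{\mathcal P}\lambda|}{|U_{\mathcal P}\lambda U_{\mathcal P}|}\sum_{\mu\in U_{\mathcal P}\lambda U_{\mathcal P}}\theta(\mu(g-1)),\qquad g\in U_{\mathcal P},\ \lambda\in\mathfrak n_{\mathcal P}^*.$$ \emph{Index pairs.} Let $\mathscr S_{\mathcal P}^*$ be the set of $\lambda\in\mathfrak n_{\mathcal P}^*$ whose support has at most one position in each row and column. For $\lambda\in\mathscr S_{\mathcal P}^*$ and $\mathcal Q\in\{\mathcal P,[[n]]\}$ let $\mathrm{coadj}^{L}_{\mathcal Q}(\lambda)$ be the set of $(j,k)\in\mathcal P$ for which there is $(i,k)\in\mathrm{supp}(\lambda)$ with $(i,j)\in\mathcal Q$, let $\mathrm{coadj}^{R}_{\mathcal Q}(\lambda)$ be the set of $(i,j)\in\mathcal P$ for which there is $(i,k)\in\mathrm{supp}(\lambda)$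 with $(j,k)\in\mathcal Q$, and let $\mathrm{coadj}_{\mathcal Q}(\lambda)$ be their union. Put $\mathrm{coaux}_{\mathcal P}(\lambda)=\mathrm{coadj}_{[[n]]}(\lambda)\setminus\mathrm{coadj}_{\mathcal P}(\lambda)$, and likewise $\mathrm{coaux}^{L}_{\mathcal P}(\lambda)=\mathrm{coadj}^{L}_{[[n]]}(\lambda)\setminus\mathrm{coadj}^{L}_{\mathcal P}(\lambda)$ and $\mathrm{coaux}^{R}_{\mathcal P}(\lambda)=\mathrm{coadj}^{R}_{[[n]]}(\lambda)\setminus\mathrm{coadj}^{R}_{\mathcal P}(\lambda)$. An \emph{index pair} is a pair $(\lambda,\eta)$ with $\lambda\in\mathscr S_{\mathcal P}^*$, $\eta\in\mathfrak n_{\mathcal P}^*$ and $\mathrm{supp}(\eta)\subset\mathrm{coaux}_{\mathcal P}(\lambda)$. Write $\eta=\eta_L+\eta_{R\setminus L}$ with $\mathrm{supp}(\eta_L)\subset\mathrm{coaux}^{L}_{\mathcal P}(\lambda)$ and $\mathrm{supp}(\eta_{R\setminus L})\subset\mathrm{coaux}^{R}_{\mathcal P}(\lambda)\setminus\mathrm{coaux}^{L}_{\mathcal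 P}(\lambda)$, and let $\mathfrak R^*_\lambda(\eta)\in\mathfrak n_{\mathcal P}^*$ have the entries $$\mathfrak R^*_\lambda(\eta)_{jk}=\eta_{jk}+\sum_{\substack{i<j<k<l\\(i,l)\in\mathrm{supp}(\lambda)}}(\eta_L)_{jl}\,(\eta_{R\setminus L})_{ik}\,\lambda_{il}^{-1},\qquad (j,k)\in\mathcal P.$$ Let $\chi_{\mathcal P}^{(\lambda,\eta)}$ be the supercharacter $\chi_{\mathcal P}^{\mu}$ with $\mu=\lambda+\mathfrak R^*_\lambda(\eta)$. \emph{Representative posets.} An $\mathbb F_q$-labeled poset is a poset $\mathcal Q$ on $[n]$ with a map $\mathcal Q^{\mathrm{cov}}\to\mathbb F_q^\times$. A set of positions is \emph{independent} if no two distinct elements share a first coordinate or share a second coordinate. For a finite set $S\subset\mathcal Q^{\mathrm{cov}}$ let $\ell_S$ be the sequence of the numbers $j-i$, $(i,j)\in S$, in weakly decreasing order, followed by zeros. A \emph{highest cover set} of $\mathcal Q$ is an independent set $S\subset\mathcal Q^{\mathrm{cov}}$ such that $\ell_S\ge\ell_T$ lexicographically for every independent $T\subset\mathcal Q^{\mathrm{cov}}$.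 Every poset $\mathcal Q$ on $[n]$ has a unique highest cover set, denoted $\mathcal Q^{\mathrm{cov}}_{\mathrm h}$. A poset $\mathcal Q$ on $[n]$ is \emph{$\mathcal P$-representative} if $\mathcal Q\subset\mathcal P$ and: (i) if $(i,k)\in\mathcal Q^{\mathrm{cov}}_{\mathrm h}$ and $(i,j)\in\mathcal Q^{\mathrm{cov}}$, then $(j,k)\notin\mathcal P$; (ii) if $(i,k)\in\mathcal Q^{\mathrm{cov}}_{\mathrm h}$ and $(j,k)\in\mathcal Q^{\mathrm{cov}}$, then $(i,j)\notin\mathcal P$. \textbf{Theorem.} Let $\mathcal P$ be a poset on $[n]$ with $\mathcal P\vartriangleleft[[n]]$. For every index pair $(\lambda,\eta)$ the set $\mathrm{supp}(\lambda+\eta)$ is the set of covers of a (unique) poset $\mathcal P^{(\lambda,\eta)}$ on $[n]$, which we label by giving the cover $(i,j)$ the label $(\lambda+\eta)_{ij}$. The maps $$\{\text{supercharacters of }U_{\mathcal P}\}\to\{\text{index pairs }(\lambda,\eta)\}\to\{\mathcal P\text{-representative }\mathbb F_q\text{-labeled posets}\},\qquad \chi_{\mathcal P}^{(\lambda,\eta)}\mapsto(\lambda,\eta)\mapsto\mathcal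 P^{(\lambda,\eta)},$$ are well defined and are both bijections. Consequently their composite is a bijection from the supercharacters of $U_{\mathcal P}$ onto the $\mathcal P$-representative $\mathbb F_q$-labeled posets. -/

import Mathlib

/-- A poset on `[n]`, realised on `Fin n`: a transitive set of positions strictly above the
diagonal. -/
@[ext]
structure PosetOn (n : ℕ) where
  carrier : Set (Fin n × Fin n)
  lt_of_mem : ∀ {i j : Fin n}, (i, j) ∈ carrier → i < j
  trans_mem : ∀ {i j k : Fin n}, (i, j) ∈ carrier → (j, k) ∈ carrier → (i, k) ∈ carrier

namespace PosetOn

variable {n : ℕ}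

/-- The poset `[[n]]` of all positions above the diagonal. -/
def full (n : ℕ) : PosetOn n where
  carrier := {p | p.1 < p.2}
  lt_of_mem h := h
  trans_mem h h' := lt_trans (α := Fin n) h h'

/-- `P ⊴ [[n]]`. -/
def IsNormal (P : PosetOn n) : Prop :=
  ∀ i j k l : Fin n, i ≤ j → j < k → k ≤ l → (i, l) ∉ P.carrier → (j, k) ∉ P.carrier

/-- The set of covers of a poset. -/
def covers (P : PosetOn n) : Set (Fin n × Fin n) :=
  {p | p ∈ P.carrier ∧ ¬ ∃ j, (p.1, j) ∈ P.carrier ∧ (j, p.2) ∈ P.carrier}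

end PosetOn

/-- No two distinct positions of `S` share a first coordinate or a second coordinate. -/
def IndependentPositions {n : ℕ} (S : Set (Fin n × Fin n)) : Prop :=
  ∀ p ∈ S, ∀ p' ∈ S, p ≠ p' → p.1 ≠ p'.1 ∧ p.2 ≠ p'.2

/-- The sequence `ℓ_S`: the numbers `j - i` for `(i, j) ∈ S` in weakly decreasing order, followed
by zeros. It lives in `Lex (ℕ → ℕ)`, so sequences are compared lexicographically. -/
def lengthSeq {n : ℕ} (S : Finset (Fin n × Fin n)) : Lex (ℕ → ℕ) :=
  toLex fun r => ((S.val.map fun p => (p.2 : ℕ) - (p.1 : ℕ)).sort (· ≥ ·)).getD r 0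

namespace PosetOn

variable {n : ℕ}

/-- `S` is a highest cover set of `P`. -/
def IsHighestCoverSet (P : PosetOn n) (S : Finset (Fin n × Fin n)) : Prop :=
  (S : Set (Fin n × Fin n)) ⊆ P.covers ∧ IndependentPositions (S : Set (Fin n × Fin n)) ∧
    ∀ T : Finset (Fin n × Fin n), (T : Set (Fin n × Fin n)) ⊆ P.covers →
      IndependentPositions (T : Set (Fin n × Fin n)) → lengthSeq T ≤ lengthSeq S

/-- `Q` is `P`-representative (here `S` is the highest cover set of `Q`, which is unique). -/
def IsRepresentative (P Q : PosetOn n) : Prop :=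
  Q.carrier ⊆ P.carrier ∧ ∃ S, Q.IsHighestCoverSet S ∧
    (∀ i j k : Fin n, (i, k) ∈ S → (i, j) ∈ Q.covers → (j, k) ∉ P.carrier) ∧
    (∀ i j k : Fin n, (i, k) ∈ S → (j, k) ∈ Q.covers → (i, j) ∉ P.carrier)

end PosetOn

/-- An `F`-labeled poset on `[n]`. The labeling of the covers by nonzero elements of `F` is
extended by zero to all positions. -/
@[ext]
structure LabeledPoset (n : ℕ) (F : Type*) [Field F] extends PosetOn n where
  label : Fin n → Fin n → F
  label_ne_zero_iff : ∀ i j, label i j ≠ 0 ↔ (i, j) ∈ toPosetOn.covers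

section PatternGroups

variable {n : ℕ} (F : Type*) [Field F]

/-- The algebra `𝔫_P` of matrices supported in `P`. -/
def nilAlg (P : PosetOn n) : Submodule F (Matrix (Fin n) (Fin n) F) where
  carrier := {X | ∀ i j, X i j ≠ 0 → (i, j) ∈ P.carrier}
  zero_mem' := fun i j h => absurd rfl h
  add_mem' := by
    intro X Y hX hY i j h
    by_contra hc
    apply h
    have h1 : X i j = 0 := by by_contra h'; exact hc (hX i j h')
    have h2 : Y i j = 0 := by by_contra h'; exact hc (hY i j h')
    simp [h1, h2]
  smul_mem' := by
    intro c X hX i j h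
    refine hX i j ?_
    intro h'
    apply h
    simp [h']

variable {F}

theorem nilAlg_mul {P : PosetOn n} {X Y : Matrix (Fin n) (Fin n) F}
    (hX : X ∈ nilAlg F P) (hY : Y ∈ nilAlg F P) : X * Y ∈ nilAlg F P := by
  intro i k h
  rw [Matrix.mul_apply] at h
  obtain ⟨j, -, hj⟩ := Finset.exists_ne_zero_of_sum_ne_zero h
  exact P.trans_mem (hX i j (left_ne_zero_of_mul hj)) (hY j k (right_ne_zero_of_mul hj))

/-- Membership in `U_P`: unit diagonal, zeros below the diagonal, and zeros at the positions above
the diagonal which are not in `P`. -/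
def IsPatternMatrix (P : PosetOn n) (g : Matrix (Fin n) (Fin n) F) : Prop :=
  (∀ i, g i i = 1) ∧ (∀ i j, j < i → g i j = 0) ∧
    ∀ i j, i < j → (i, j) ∉ P.carrier → g i j = 0

theorem isPatternMatrix_iff {P : PosetOn n} {g : Matrix (Fin n) (Fin n) F} :
    IsPatternMatrix P g ↔ g - 1 ∈ nilAlg F P := by
  constructor
  · rintro ⟨h1, h2, h3⟩ i j h
    rcases lt_trichotomy i j with hij | rfl | hij
    · by_contra hc
      exact h (by simp [hij.ne, h3 i j hij hc])
    · exact absurd (by simp [h1]) h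
    · exact absurd (by simp [hij.ne', h2 i j hij]) h
  · intro h
    refine ⟨fun i => ?_, fun i j hij => ?_, fun i j hij hP => ?_⟩
    · by_contra hc
      refine lt_irrefl i (P.lt_of_mem (h i i ?_))
      simpa [sub_eq_zero] using hc
    · by_contra hc
      refine lt_asymm hij (P.lt_of_mem (h i j ?_))
      simpa [hij.ne'] using hc
    · by_contra hc
      refine hP (h i j ?_)
      simpa [hij.ne] using hc

theorem IsPatternMatrix.mul {P : PosetOn n} {g h : Matrix (Fin n) (Fin n) F}
    (hg : IsPatternMatrix P g) (hh : IsPatternMatrix P h) : IsPatternMatrix P (g * h) := by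
  rw [isPatternMatrix_iff] at *
  have : g * h - 1 = (g - 1) * (h - 1) + (g - 1) + (h - 1) := by noncomm_ring
  rw [this]
  exact add_mem (add_mem (nilAlg_mul hg hh) hg) hh

variable (F) in
/-- The pattern group `U_P`. -/
def patternGroup [Finite F] (P : PosetOn n) : Subgroup (GL (Fin n) F) where
  carrier := {g | IsPatternMatrix P (g : Matrix (Fin n) (Fin n) F)}
  one_mem' := by
    rw [Set.mem_ofPred_eq, isPatternMatrix_iff]
    simp
  mul_mem' := fun {g h} hg hh => by
    rw [Set.mem_ofPred_eq, Units.val_mul]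
    exact IsPatternMatrix.mul hg hh
  inv_mem' := fun {g} hg => by
    have hpow : ∀ m : ℕ, IsPatternMatrix P ((g ^ m : GL (Fin n) F) : Matrix (Fin n) (Fin n) F) := by
      intro m
      induction m with
      | zero =>
        rw [isPatternMatrix_iff]
        simp
      | succ m ih =>
        rw [pow_succ, Units.val_mul]
        exact IsPatternMatrix.mul ih hg
    have hmem : g⁻¹ ∈ Submonoid.powers g :=
      mem_powers_iff_mem_zpowers.2 (Subgroup.inv_mem _ (Subgroup.mem_zpowers g))
    obtain ⟨m, hm⟩ := hmem
    have hm' : g ^ m = g⁻¹ := hm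
    rw [Set.mem_ofPred_eq, ← hm']
    exact hpow m

theorem nilAlg_left {P : PosetOn n} {g X : Matrix (Fin n) (Fin n) F}
    (hg : IsPatternMatrix P g) (hX : X ∈ nilAlg F P) : g * X ∈ nilAlg F P := by
  have : g * X = (g - 1) * X + X := by noncomm_ring
  rw [this]
  exact add_mem (nilAlg_mul (isPatternMatrix_iff.1 hg) hX) hX

theorem nilAlg_right {P : PosetOn n} {g X : Matrix (Fin n) (Fin n) F}
    (hg : IsPatternMatrix P g) (hX : X ∈ nilAlg F P) : X * g ∈ nilAlg F P := by
  have : X * g = X * (g - 1) + X := by noncomm_ring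
  rw [this]
  exact add_mem (nilAlg_mul hX (isPatternMatrix_iff.1 hg)) hX

variable (F) in
/-- The dual space `𝔫_P^*`. -/
abbrev NilDual (P : PosetOn n) : Type _ := Module.Dual F (nilAlg F P)

section Actions

variable [Finite F] {P : PosetOn n}

/-- Left multiplication by an element of `U_P` on `𝔫_P`. -/
def leftMul (g : patternGroup F P) : nilAlg F P →ₗ[F] nilAlg F P where
  toFun X := ⟨((g : GL (Fin n) F) : Matrix (Fin n) (Fin n) F) * X, nilAlg_left g.2 X.2⟩
  map_add' X Y := Subtype.ext (by simp [mul_add])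
  map_smul' c X := Subtype.ext (by simp)

/-- Right multiplication by an element of `U_P` on `𝔫_P`. -/
def rightMul (g : patternGroup F P) : nilAlg F P →ₗ[F] nilAlg F P where
  toFun X := ⟨(X : Matrix (Fin n) (Fin n) F) * ((g : GL (Fin n) F) : Matrix (Fin n) (Fin n) F),
    nilAlg_right g.2 X.2⟩
  map_add' X Y := Subtype.ext (by simp [add_mul])
  map_smul' c X := Subtype.ext (by simp)

/-- `(gλ)(X) = λ(g⁻¹X)`. -/
def leftAct (g : patternGroup F P) (lam : NilDual F P) : NilDual F P := lam ∘ₗ leftMul g⁻¹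

/-- `(λg)(X) = λ(Xg⁻¹)`. -/
def rightAct (lam : NilDual F P) (g : patternGroup F P) : NilDual F P := lam ∘ₗ rightMul g⁻¹

/-- The left orbit `U_P λ`. -/
def leftOrbit (lam : NilDual F P) : Set (NilDual F P) :=
  Set.range fun g : patternGroup F P => leftAct g lam

/-- The two-sided orbit `U_P λ U_P`. -/
def twoSidedOrbit (lam : NilDual F P) : Set (NilDual F P) :=
  Set.range fun gh : patternGroup F P × patternGroup F P => rightAct (leftAct gh.1 lam) gh.2

/-- The element `g - 1` of `𝔫_P`, for `g ∈ U_P`. -/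
def subOne (g : patternGroup F P) : nilAlg F P :=
  ⟨((g : GL (Fin n) F) : Matrix (Fin n) (Fin n) F) - 1, isPatternMatrix_iff.1 g.2⟩

/-- The supercharacter `χ_P^λ`. -/
noncomputable def superchar (θ : AddChar F ℂ) (lam : NilDual F P) : patternGroup F P → ℂ :=
  fun g => ((leftOrbit lam).ncard : ℂ) / ((twoSidedOrbit lam).ncard : ℂ) *
    ∑ᶠ μ ∈ twoSidedOrbit lam, θ (μ (subOne g))

variable (P) in
/-- The set of supercharacters of `U_P`. -/
def supercharacters (θ : AddChar F ℂ) : Set (patternGroup F P → ℂ) :=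
  Set.range fun lam : NilDual F P => superchar θ lam

end Actions

section Dual

variable {P : PosetOn n}

open Classical in
/-- The entry `λ_ij`: equal to `λ(e_ij)` if `(i, j) ∈ P`, and zero otherwise. -/
noncomputable def entry (lam : NilDual F P) (i j : Fin n) : F :=
  if h : (i, j) ∈ P.carrier then
    lam ⟨Matrix.single i j 1, fun a b hab => by
      by_cases hc : i = a ∧ j = b
      · rw [← hc.1, ← hc.2]; exact h
      · exact absurd (Matrix.single_apply_of_ne i j (1 : F) a b hc) hab⟩
  else 0

/-- `supp(λ)`. -/
def dualSupp (lam : NilDual F P) : Set (Fin n × Fin n) := {p | entry lam p.1 p.2 ≠ 0}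

variable (P) in
/-- The functional on `𝔫_P` whose entry at each position `(i, j) ∈ P` is `A i j`. -/
noncomputable def dualOfEntries (A : Fin n → Fin n → F) : NilDual F P where
  toFun X := ∑ i, ∑ j, A i j * (X : Matrix (Fin n) (Fin n) F) i j
  map_add' X Y := by simp [mul_add, Finset.sum_add_distrib]
  map_smul' c X := by simp [Finset.mul_sum, mul_left_comm]

/-- `λ` is an `F`-labeled set partition: it lies in `𝒮_P^*`. -/
def IsSetPartition (lam : NilDual F P) : Prop := IndependentPositions (dualSupp lam)

/-- `coadj_Q^L(λ)`, for `λ ∈ 𝔫_P^*`. -/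
def coadjL (Q : PosetOn n) (lam : NilDual F P) : Set (Fin n × Fin n) :=
  {p | p ∈ P.carrier ∧ ∃ i, (i, p.2) ∈ dualSupp lam ∧ (i, p.1) ∈ Q.carrier}

/-- `coadj_Q^R(λ)`, for `λ ∈ 𝔫_P^*`. -/
def coadjR (Q : PosetOn n) (lam : NilDual F P) : Set (Fin n × Fin n) :=
  {p | p ∈ P.carrier ∧ ∃ k, (p.1, k) ∈ dualSupp lam ∧ (p.2, k) ∈ Q.carrier}

/-- `coaux_P^L(λ)`. -/
def coauxL (lam : NilDual F P) : Set (Fin n × Fin n) := coadjL (PosetOn.full n) lam \ coadjL P lam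

/-- `coaux_P^R(λ)`. -/
def coauxR (lam : NilDual F P) : Set (Fin n × Fin n) := coadjR (PosetOn.full n) lam \ coadjR P lam

/-- `coaux_P(λ)`. -/
def coaux (lam : NilDual F P) : Set (Fin n × Fin n) :=
  (coadjL (PosetOn.full n) lam ∪ coadjR (PosetOn.full n) lam) \ (coadjL P lam ∪ coadjR P lam)

open Classical in
/-- The product `η *_λ μ`. -/
noncomputable def starProd (lam η μ : NilDual F P) : NilDual F P :=
  dualOfEntries P fun j k => entry η j k + entry μ j k +
    ∑ i, ∑ l, if i < j ∧ j < k ∧ k < l ∧ (i, l) ∈ dualSupp lam then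
      entry η j l * entry μ i k * (entry lam i l)⁻¹ else 0

open Classical in
/-- The part of `η` supported in `T`. -/
noncomputable def restrictTo (T : Set (Fin n × Fin n)) (η : NilDual F P) : NilDual F P :=
  dualOfEntries P fun i j => if (i, j) ∈ T then entry η i j else 0

/-- `ℜ^*_λ(η) = η_L *_λ η_{R∖L}`. -/
noncomputable def coRep (lam η : NilDual F P) : NilDual F P :=
  starProd lam (restrictTo (coauxL lam) η) (restrictTo (coauxR lam \ coauxL lam) η)

variable (F P) in
/-- The pairs `(λ, η)` with `λ ∈ 𝒮_P^*`, `η ∈ 𝔫_P^*` and `supp(η) ⊆ coaux_P(λ)`. -/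
@[ext]
structure IndexPair where
  lam : NilDual F P
  eta : NilDual F P
  isSetPartition : IsSetPartition lam
  supp_eta : dualSupp eta ⊆ coaux lam

/-- The supercharacter `χ_P^{(λ,η)}`. -/
noncomputable def IndexPair.superchar [Finite F] (θ : AddChar F ℂ) (p : IndexPair F P) :
    supercharacters P θ :=
  ⟨_root_.superchar θ (p.lam + coRep p.lam p.eta), Set.mem_range_self _⟩

theorem dualSupp_subset (lam : NilDual F P) : dualSupp lam ⊆ P.carrier := by
  rintro ⟨i, j⟩ h
  by_contra hc
  exact h (dif_neg hc)

theorem entry_add (lam μ : NilDual F P) (i j : Fin n) :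
    entry (lam + μ) i j = entry lam i j + entry μ i j := by
  unfold entry
  split_ifs <;> simp

theorem IndexPair.mem_supp_or (p : IndexPair F P) {x : Fin n × Fin n}
    (hx : x ∈ dualSupp (p.lam + p.eta)) : x ∈ dualSupp p.lam ∨ x ∈ coaux p.lam := by
  by_cases h : x ∈ dualSupp p.lam
  · exact Or.inl h
  · refine Or.inr (p.supp_eta fun h' => hx ?_)
    have h0 : entry p.lam x.1 x.2 = 0 := not_not.1 h
    rw [entry_add, h0, h', add_zero]

/-- The relation generated by a set of positions: `i` and `k` are joined by a nonempty chain of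
positions in `S`. -/
def chainRel (S : Set (Fin n × Fin n)) : Fin n → Fin n → Prop :=
  Relation.TransGen fun i j => (i, j) ∈ S

theorem chainRel_mem {Q : PosetOn n} {S : Set (Fin n × Fin n)} (hS : S ⊆ Q.carrier) {i k : Fin n}
    (h : chainRel S i k) : (i, k) ∈ Q.carrier := by
  induction h with
  | single h => exact hS h
  | tail _ h ih => exact Q.trans_mem ih (hS h)

theorem IndexPair.not_chain (hP : P.IsNormal) (p : IndexPair F P) {i j k : Fin n}
    (hik : (i, k) ∈ dualSupp (p.lam + p.eta)) (hij : chainRel (dualSupp (p.lam + p.eta)) i j)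
    (hjk : chainRel (dualSupp (p.lam + p.eta)) j k) : False := by
  have hN : ∀ {a b c d : Fin n}, a ≤ b → c ≤ d → (b, c) ∈ P.carrier → (a, d) ∈ P.carrier := by
    intro a b c d hab hcd hbc
    by_contra hc
    exact hP a b c d hab (P.lt_of_mem hbc) hcd hc hbc
  have hsub := dualSupp_subset (p.lam + p.eta)
  have hind := p.isSetPartition
  -- the first step `(i, a)` and the last step `(b, k)` of the chain
  obtain ⟨a, hia, haj⟩ : ∃ a, (i, a) ∈ dualSupp (p.lam + p.eta) ∧ a ≤ j := by
    rcases Relation.TransGen.head'_iff.1 hij with ⟨a, ha, haj⟩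
    refine ⟨a, ha, ?_⟩
    rcases Relation.reflTransGen_iff_eq_or_transGen.1 haj with h | h
    · exact h.ge
    · exact (P.lt_of_mem (chainRel_mem hsub h)).le
  obtain ⟨b, hbk, hjb⟩ : ∃ b, (b, k) ∈ dualSupp (p.lam + p.eta) ∧ j ≤ b := by
    rcases Relation.TransGen.tail'_iff.1 hjk with ⟨b, hjb, hb⟩
    refine ⟨b, hb, ?_⟩
    rcases Relation.reflTransGen_iff_eq_or_transGen.1 hjb with h | h
    · exact h.ge
    · exact (P.lt_of_mem (chainRel_mem hsub h)).le
  have hab : a ≤ b := haj.trans hjb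
  have hiaP := hsub hia
  have hbkP := hsub hbk
  have hib : i < b := (P.lt_of_mem hiaP).trans_le hab
  have hak : a < k := hab.trans_lt (P.lt_of_mem hbkP)
  rcases p.mem_supp_or hik with h | h
  · -- `(i, k)` is in the support of `λ`
    rcases p.mem_supp_or hia with h' | h'
    · exact (hind _ h _ h' fun e => hak.ne' (Prod.ext_iff.1 e).2).1 rfl
    · exact h'.2 (Or.inr ⟨hiaP, k, h, hN hab le_rfl hbkP⟩)
  · rcases h.1 with ⟨_, c, hck, hci⟩ | ⟨_, d, hid, hkd⟩
    · have hci' : c < i := hci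
      rcases p.mem_supp_or hbk with h' | h'
      · exact (hind _ hck _ h' fun e => (hci'.trans hib).ne (Prod.ext_iff.1 e).1).2 rfl
      · exact h'.2 (Or.inl ⟨hbkP, c, hck, hN hci'.le hab hiaP⟩)
    · have hkd' : k < d := hkd
      rcases p.mem_supp_or hia with h' | h'
      · exact (hind _ hid _ h' fun e => (hak.trans hkd').ne' (Prod.ext_iff.1 e).2).1 rfl
      · exact h'.2 (Or.inr ⟨hiaP, d, hid, hN hab hkd'.le hbkP⟩)

/-- The labeled poset `P^{(λ,η)}`: its covers are the positions in `supp(λ + η)`, it consists of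
all `(i, k)` joined by a chain of these covers, and the cover `(i, j)` is labeled by
`(λ + η)_ij`. -/
noncomputable def IndexPair.toLabeledPoset (hP : P.IsNormal) (p : IndexPair F P) :
    LabeledPoset n F where
  carrier := {x | chainRel (dualSupp (p.lam + p.eta)) x.1 x.2}
  lt_of_mem := fun h => P.lt_of_mem (chainRel_mem (dualSupp_subset _) h)
  trans_mem := fun h h' => Relation.TransGen.trans h h'
  label := fun i j => entry (p.lam + p.eta) i j
  label_ne_zero_iff := by
    intro i k
    constructor
    · intro h
      exact ⟨Relation.TransGen.single h, fun ⟨_, hij, hjk⟩ => p.not_chain hP h hij hjk⟩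
    · rintro ⟨h, hc⟩
      rcases Relation.TransGen.head'_iff.1 h with ⟨a, ha, hak⟩
      rcases Relation.reflTransGen_iff_eq_or_transGen.1 hak with e | h'
      · have e' : k = a := e
        subst e'
        exact ha
      · exact absurd ⟨a, Relation.TransGen.single ha, h'⟩ hc

end Dual

end PatternGroups

/-! A functional on `𝔫_P` is recorded by its matrix `M` of entries. By the trace pairing, the
two-sided action of `U_P` becomes `M ↦ A * M * B` with `A`, `B` transposes of elements of `U_P`,
read only in the positions of `P`. Because `P` is normal, every lower unitriangular matrix acts on
matrices read in `P`, and it normalizes the transposed `U_P`. Hence `M` may be replaced by a Bruhat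
product `G * L * H` whose middle factor `L` has at most one nonzero entry in each row and column and
is supported in `P`.

It remains to see how much of `G` and `H` survives modulo `U_P`. Elementary factors outside
`leftFree` and `rightFree` can be absorbed, which leaves a normal form `A * L * B`
(`exists_patternEquiv_normalForm`), and this form is unique (`PatternEquiv.normalForm_unique`).
Expanding it as `L + (A - 1) * L + L * (B - 1) + (A - 1) * L * (B - 1)` gives `λ`, `η_L`, `η_{R∖L}`
and the correction term of `ℜ^*_λ(η)`, so normal forms are index pairs and index pairs parametrize
the orbits. Linear independence of additive characters shows that distinct orbits have distinct
supercharacters.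

The second bijection is combinatorial. The highest cover set is the one independent set of covers
such that each other cover shares its row or column with a longer member. Positions of `coaux` have
this property relative to `supp(λ)`, so `supp(λ)` is the highest cover set of `P^{(λ,η)}` and the
poset determines `λ`. Conversely, conditions (i) and (ii) say that the covers outside the highest
cover set avoid `coadj_P`. -/

/-! ### Highest cover sets are the greedy sets of covers. -/

/-- The number of positions in `S` of length at least `d`. -/
def lengthCount {n : ℕ} (S : Finset (Fin n × Fin n)) (d : ℕ) : ℕ :=
  (S.filter fun p => d ≤ (p.2 : ℕ) - (p.1 : ℕ)).card

/-- In a weakly decreasing list the entries that are at least `d` form an initial segment.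
Positivity of `d` excludes the default value `0` beyond the end. -/
theorem List.le_getD_iff_lt_countP {l : List ℕ} (hl : l.Pairwise (· ≥ ·)) {d : ℕ} (hd : 0 < d)
    (r : ℕ) : d ≤ l.getD r 0 ↔ r < l.countP (d ≤ ·) := by
  induction l generalizing r with
  | nil => simp; omega
  | cons a l ih =>
    rw [List.pairwise_cons] at hl
    by_cases ha : d ≤ a
    · cases r with
      | zero => simp [ha]
      | succ r => simpa [ha] using ih hl.2 r
    · have h0 : l.countP (d ≤ ·) = 0 := by
        rw [List.countP_eq_zero]
        intro x hx
        have := hl.1 x hx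
        simp only [decide_eq_true_eq]
        omega
      cases r with
      | zero => simp [ha, h0]
      | succ r =>
        have := ih hl.2 r
        simpa [ha, h0] using this

theorem le_lengthSeq_iff {n : ℕ} (S : Finset (Fin n × Fin n)) {d : ℕ} (hd : 0 < d) (r : ℕ) :
    d ≤ ofLex (lengthSeq S) r ↔ r < lengthCount S d := by
  unfold lengthSeq lengthCount
  rw [ofLex_toLex, List.le_getD_iff_lt_countP (Multiset.pairwise_sort _ _) hd,
    ← Multiset.coe_countP, Multiset.sort_eq, Multiset.countP_map, Finset.card_def,
    Finset.filter_val]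

theorem lengthSeq_lt_of_lengthCount {n : ℕ} {S T : Finset (Fin n × Fin n)} {d : ℕ} (hd : 0 < d)
    (hgt : ∀ e, d < e → lengthCount T e = lengthCount S e)
    (hlt : lengthCount T d < lengthCount S d) : lengthSeq T < lengthSeq S := by
  -- At the indices before this one both entries are at least `d`, so they are determined by the
  -- counts above `d`. At this index only `S` still has an entry that is at least `d`.
  refine ⟨lengthCount T d, fun r hr => ?_, ?_⟩
  · have h1 := (le_lengthSeq_iff T hd r).2 hr
    have h2 := (le_lengthSeq_iff S hd r).2 (hr.trans hlt)
    refine eq_of_forall_le_iff fun e => ?_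
    rcases le_or_gt e d with h | h
    · exact ⟨fun _ => h.trans h2, fun _ => h.trans h1⟩
    · have := le_lengthSeq_iff T (hd.trans h) r
      rw [hgt e h, ← le_lengthSeq_iff S (hd.trans h) r] at this
      exact this
  · have h1 := (le_lengthSeq_iff S hd _).2 hlt
    have h2 := mt (le_lengthSeq_iff T hd _).1 (lt_irrefl (lengthCount T d))
    exact (not_le.1 h2).trans_le h1

/-- `S` is obtained from `C` greedily: it is independent, and each other position of `C` shares a
row or column with a longer position of `S`. -/
def IsGreedy {n : ℕ} (C : Set (Fin n × Fin n)) (S : Finset (Fin n × Fin n)) : Prop :=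
  (S : Set (Fin n × Fin n)) ⊆ C ∧ IndependentPositions (S : Set (Fin n × Fin n)) ∧
    ∀ i k, (i, k) ∈ C → (i, k) ∉ S → (∃ l, (i, l) ∈ S ∧ k < l) ∨ ∃ h, (h, k) ∈ S ∧ h < i

/-- Let `d` be the largest length at which the sets differ. A position of `T` of length `d` outside
`S` would meet a longer position of `S`, which also lies in `T`, against independence. So at length
`d` the set `T` is properly contained in `S`. -/
theorem IsGreedy.lengthSeq_lt {n : ℕ} {C : Set (Fin n × Fin n)} {S T : Finset (Fin n × Fin n)}
    (hC : ∀ i j, (i, j) ∈ C → i < j) (hS : IsGreedy C S) (hTC : (T : Set (Fin n × Fin n)) ⊆ C)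
    (hT : IndependentPositions (T : Set (Fin n × Fin n))) (hne : T ≠ S) :
    lengthSeq T < lengthSeq S := by
  classical
  have hex : ∃ d p, (p ∈ T ∧ p ∉ S ∨ p ∈ S ∧ p ∉ T) ∧ (p.2 : ℕ) - (p.1 : ℕ) = d := by
    by_contra! h
    refine hne (Finset.ext fun p => ?_)
    by_contra hc
    exact h _ p (by tauto) rfl
  obtain ⟨d, ⟨p, hp, hpd⟩, hmax⟩ : ∃ d, (∃ p, (p ∈ T ∧ p ∉ S ∨ p ∈ S ∧ p ∉ T) ∧
      (p.2 : ℕ) - (p.1 : ℕ) = d) ∧ ∀ e, d < e → ∀ p : Fin n × Fin n,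
      (p.2 : ℕ) - (p.1 : ℕ) = e → (p ∈ T ↔ p ∈ S) := by
    have hb : ∀ e, (∃ p, (p ∈ T ∧ p ∉ S ∨ p ∈ S ∧ p ∉ T) ∧ (p.2 : ℕ) - (p.1 : ℕ) = e) →
        e ≤ n := by
      rintro e ⟨p, -, hp⟩
      omega
    obtain ⟨d, hd⟩ := hex
    refine ⟨_, Nat.findGreatest_spec (P := fun e => ∃ p, (p ∈ T ∧ p ∉ S ∨ p ∈ S ∧ p ∉ T) ∧
      (p.2 : ℕ) - (p.1 : ℕ) = e) (hb d hd) hd, fun e he p hp => ?_⟩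
    by_contra hc
    have h : ∃ p, (p ∈ T ∧ p ∉ S ∨ p ∈ S ∧ p ∉ T) ∧ (p.2 : ℕ) - (p.1 : ℕ) = e :=
      ⟨p, by tauto, hp⟩
    exact Nat.findGreatest_is_greatest he (hb e h) h
  have hsub : ∀ q : Fin n × Fin n, (q.2 : ℕ) - (q.1 : ℕ) = d → q ∈ T → q ∈ S := by
    rintro ⟨i, k⟩ hq hqT
    by_contra hqS
    have hik := hC i k (hTC hqT)
    simp only at hq
    rcases hS.2.2 i k (hTC hqT) hqS with ⟨l, hl, hkl⟩ | ⟨h, hh, hhi⟩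
    · have : (i, l) ∈ T := (hmax _ (by simp only; omega) (i, l) rfl).2 hl
      exact (hT _ hqT _ this fun e => hkl.ne (Prod.ext_iff.1 e).2).1 rfl
    · have : (h, k) ∈ T := (hmax _ (by simp only; omega) (h, k) rfl).2 hh
      exact (hT _ hqT _ this fun e => hhi.ne' (Prod.ext_iff.1 e).1).2 rfl
  have hpS : p ∈ S ∧ p ∉ T := by
    rcases hp with h | h
    · exact absurd (hsub p hpd h.1) h.2
    · exact h
  have hp12 := hC p.1 p.2 (hS.1 hpS.1)
  refine lengthSeq_lt_of_lengthCount (d := d) (by omega) (fun e he => ?_) ?_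
  · unfold lengthCount
    congr 1
    ext q
    simp only [Finset.mem_filter, and_congr_left_iff]
    intro hq
    exact hmax _ (he.trans_le hq) q rfl
  · refine Finset.card_lt_card (Finset.ssubset_iff_of_subset ?_ |>.2 ⟨p, ?_, ?_⟩)
    · intro q hq
      rw [Finset.mem_filter] at hq ⊢
      refine ⟨?_, hq.2⟩
      rcases hq.2.lt_or_eq with h | h
      · exact (hmax _ h q rfl).1 hq.1
      · exact hsub q h.symm hq.1
    · exact Finset.mem_filter.2 ⟨hpS.1, hpd.ge⟩
    · exact fun h => hpS.2 (Finset.mem_filter.1 h).1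

namespace PosetOn

variable {n : ℕ} (Q : PosetOn n)

/-- A cover blocked by no longer member of `S` could be added after discarding the shorter members;
the result is independent and beats `S`, whatever was discarded. -/
theorem IsHighestCoverSet.isGreedy {Q : PosetOn n} {S : Finset (Fin n × Fin n)}
    (hS : Q.IsHighestCoverSet S) : IsGreedy Q.covers S := by
  classical
  refine ⟨hS.1, hS.2.1, fun i k hik hikS => ?_⟩
  by_contra! hc
  have hlt : i < k := Q.lt_of_mem hik.1
  set T := insert (i, k) (S.filter fun p => (k : ℕ) - (i : ℕ) ≤ (p.2 : ℕ) - (p.1 : ℕ)) with hTdef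
  have hconf : ∀ p ∈ S, (k : ℕ) - (i : ℕ) ≤ (p.2 : ℕ) - (p.1 : ℕ) → i ≠ p.1 ∧ k ≠ p.2 := by
    rintro ⟨a, b⟩ hp hle
    have hab : a < b := Q.lt_of_mem (hS.1 hp).1
    simp only at hle ⊢
    constructor
    · rintro rfl
      have h := hc.1 b hp
      exact hikS (by rwa [show k = b by omega])
    · rintro rfl
      have h := hc.2 a hp
      exact hikS (by rwa [show i = a by omega])
  have hT : lengthSeq T ≤ lengthSeq S := by
    refine hS.2.2 T ?_ ?_
    · intro p hp
      rcases Finset.mem_insert.1 (Finset.mem_coe.1 hp) with rfl | hp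
      · exact hik
      · exact hS.1 (Finset.mem_filter.1 hp).1
    · intro p hp q hq hne
      rcases Finset.mem_insert.1 (Finset.mem_coe.1 hp) with rfl | hp <;>
        rcases Finset.mem_insert.1 (Finset.mem_coe.1 hq) with rfl | hq
      · exact absurd rfl hne
      · rw [Finset.mem_filter] at hq
        exact hconf q hq.1 hq.2
      · rw [Finset.mem_filter] at hp
        exact (hconf p hp.1 hp.2).imp Ne.symm Ne.symm
      · exact hS.2.1 p (Finset.mem_filter.1 hp).1 q (Finset.mem_filter.1 hq).1 hne
  refine absurd hT (not_le.2 (lengthSeq_lt_of_lengthCount (d := (k : ℕ) - (i : ℕ)) (by omega)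
    (fun e he => ?_) ?_))
  · unfold lengthCount
    congr 1
    ext q
    rw [hTdef]
    simp only [Finset.mem_filter, Finset.mem_insert]
    constructor
    · rintro ⟨h, h'⟩
      exact ⟨Or.inr ⟨h, he.le.trans h'⟩, h'⟩
    · rintro ⟨rfl | h, h'⟩
      · simp only at h'
        omega
      · exact ⟨h.1, h'⟩
  · refine Finset.card_lt_card (Finset.ssubset_iff_of_subset ?_ |>.2 ⟨(i, k), ?_, ?_⟩)
    · intro q hq
      rw [Finset.mem_filter] at hq
      rw [Finset.mem_filter, hTdef, Finset.mem_insert, Finset.mem_filter]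
      exact ⟨Or.inr hq, hq.2⟩
    · rw [Finset.mem_filter]
      exact ⟨Finset.mem_insert_self _ _, le_rfl⟩
    · exact fun h => hikS (Finset.mem_filter.1 h).1

theorem isHighestCoverSet_of_isGreedy {Q : PosetOn n} {S : Finset (Fin n × Fin n)}
    (hS : IsGreedy Q.covers S) : Q.IsHighestCoverSet S := by
  refine ⟨hS.1, hS.2.1, fun T hT hTi => ?_⟩
  by_cases h : T = S
  · rw [h]
  · exact (hS.lengthSeq_lt (fun i j h => Q.lt_of_mem h.1) hT hTi h).le

theorem IsHighestCoverSet.unique {Q : PosetOn n} {S T : Finset (Fin n × Fin n)}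
    (hS : Q.IsHighestCoverSet S) (hT : Q.IsHighestCoverSet T) : T = S := by
  by_contra h
  exact absurd (hT.2.2 S hS.1 hS.2.1)
    (not_le.2 (hS.isGreedy.lengthSeq_lt (fun i j h => Q.lt_of_mem h.1) hT.1 hT.2.1 h))

theorem existsUnique_isHighestCoverSet : ∃! S : Finset (Fin n × Fin n), Q.IsHighestCoverSet S := by
  classical
  obtain ⟨S, hS, hmax⟩ := Set.exists_max_image
    {S : Finset (Fin n × Fin n) | (S : Set (Fin n × Fin n)) ⊆ Q.covers ∧
      IndependentPositions (S : Set (Fin n × Fin n))} lengthSeq (Set.toFinite _)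
    ⟨∅, by simp, by simp [IndependentPositions]⟩
  have hS' : Q.IsHighestCoverSet S := ⟨hS.1, hS.2, fun T hT hTi => hmax T ⟨hT, hTi⟩⟩
  exact ⟨S, hS', fun T hT => hS'.unique hT⟩

theorem chainRel_covers {i k : Fin n} (h : (i, k) ∈ Q.carrier) : chainRel Q.covers i k := by
  induction hd : (k : ℕ) - (i : ℕ) using Nat.strong_induction_on generalizing i k with
  | _ d ih =>
    by_cases hc : ∃ j, (i, j) ∈ Q.carrier ∧ (j, k) ∈ Q.carrier
    · obtain ⟨j, hij, hjk⟩ := hc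
      have h1 : i < j := Q.lt_of_mem hij
      have h2 : j < k := Q.lt_of_mem hjk
      exact (ih _ (by omega) hij rfl).trans (ih _ (by omega) hjk rfl)
    · exact Relation.TransGen.single ⟨h, hc⟩

end PosetOn

/-! ### Entries of functionals; index pairs and representative posets. -/

section DualEntries

variable {n : ℕ} {F : Type*} [Field F] {P : PosetOn n}

theorem entry_of_notMem (lam : NilDual F P) {i j : Fin n} (h : (i, j) ∉ P.carrier) :
    entry lam i j = 0 :=
  dif_neg h

theorem apply_eq_sum_entry (lam : NilDual F P) (X : nilAlg F P) :
    lam X = ∑ i, ∑ j, entry lam i j * (X : Matrix (Fin n) (Fin n) F) i j := by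
  classical
  have hX : X = ∑ i, ∑ j, (if h : (i, j) ∈ P.carrier then
      (X : Matrix (Fin n) (Fin n) F) i j • (⟨Matrix.single i j 1, fun a b hab => by
      by_cases hc : i = a ∧ j = b
      · rw [← hc.1, ← hc.2]; exact h
      · exact absurd (Matrix.single_apply_of_ne i j (1 : F) a b hc) hab⟩ : nilAlg F P) else 0) := by
    apply Subtype.ext
    conv_lhs => rw [Matrix.matrix_eq_sum_single (X : Matrix (Fin n) (Fin n) F)]
    push_cast
    refine Finset.sum_congr rfl fun i _ => Finset.sum_congr rfl fun j _ => ?_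
    split_ifs with h
    · simp [Matrix.smul_single]
    · have : (X : Matrix (Fin n) (Fin n) F) i j = 0 := by
        by_contra hc
        exact h (X.2 i j hc)
      simp [this]
  conv_lhs => rw [hX]
  rw [map_sum]
  refine Finset.sum_congr rfl fun i _ => ?_
  rw [map_sum]
  refine Finset.sum_congr rfl fun j _ => ?_
  unfold entry
  split_ifs with h
  · rw [map_smul, smul_eq_mul, mul_comm]
  · simp

theorem dual_ext_entry {lam μ : NilDual F P} (h : ∀ i j, entry lam i j = entry μ i j) :
    lam = μ := by
  ext X
  simp only [apply_eq_sum_entry, h]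

theorem entry_dualOfEntries (A : Fin n → Fin n → F) {i j : Fin n} (h : (i, j) ∈ P.carrier) :
    entry (dualOfEntries P A) i j = A i j := by
  unfold entry dualOfEntries
  rw [dif_pos h]
  simp only [LinearMap.coe_mk, AddHom.coe_mk]
  rw [Finset.sum_eq_single i, Finset.sum_eq_single j]
  · simp
  · intro b _ hb
    simp [hb.symm]
  · simp
  · intro b _ hb
    simp [hb.symm]
  · simp

theorem entry_dualOfEntries_of_support {A : Fin n → Fin n → F}
    (hA : ∀ i j, A i j ≠ 0 → (i, j) ∈ P.carrier) (i j : Fin n) :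
    entry (dualOfEntries P A) i j = A i j := by
  by_cases h : (i, j) ∈ P.carrier
  · exact entry_dualOfEntries A h
  · rw [entry_of_notMem _ h]
    by_contra hc
    exact h (hA i j (Ne.symm hc))

open Classical in
theorem entry_restrictTo (T : Set (Fin n × Fin n)) (η : NilDual F P) (i j : Fin n) :
    entry (restrictTo T η) i j = if (i, j) ∈ T then entry η i j else 0 := by
  refine entry_dualOfEntries_of_support (fun i j h => ?_) i j
  split_ifs at h with hT
  · exact dualSupp_subset η h
  · exact absurd rfl h

theorem disjoint_dualSupp_coaux {lam : NilDual F P} (h : IsSetPartition lam) {p : Fin n × Fin n}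
    (hp : p ∈ dualSupp lam) : p ∉ coaux lam := by
  obtain ⟨i, k⟩ := p
  rintro ⟨⟨_, a, ha, hai⟩ | ⟨_, a, ha, hka⟩, -⟩
  · exact (h _ hp _ ha fun e => (ne_of_gt (show a < i from hai)) (Prod.ext_iff.1 e).1).2 rfl
  · exact (h _ hp _ ha fun e => (ne_of_lt (show k < a from hka)) (Prod.ext_iff.1 e).2).1 rfl

namespace IndexPair

theorem entry_eta_of_mem (p : IndexPair F P) {i j : Fin n} (h : (i, j) ∈ dualSupp p.lam) :
    entry p.eta i j = 0 := by
  by_contra hc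
  exact disjoint_dualSupp_coaux p.isSetPartition h (p.supp_eta hc)

theorem entry_lam_of_notMem (p : IndexPair F P) {i j : Fin n} (h : (i, j) ∉ dualSupp p.lam) :
    entry p.lam i j = 0 :=
  not_not.1 h

theorem dualSupp_subset_add (p : IndexPair F P) : dualSupp p.lam ⊆ dualSupp (p.lam + p.eta) := by
  rintro ⟨i, j⟩ h
  change entry (p.lam + p.eta) i j ≠ 0
  rw [entry_add, p.entry_eta_of_mem h, add_zero]
  exact h

theorem covers_toLabeledPoset (hP : P.IsNormal) (p : IndexPair F P) :
    (p.toLabeledPoset hP).covers = dualSupp (p.lam + p.eta) :=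
  Set.ext fun x => ((p.toLabeledPoset hP).label_ne_zero_iff x.1 x.2).symm

/-- A cover outside `supp(λ)` lies in `coaux`, hence has a strictly longer position of `supp(λ)` in
its row or column. So `supp(λ)` is greedy. -/
theorem isHighestCoverSet (hP : P.IsNormal) (p : IndexPair F P) {S : Finset (Fin n × Fin n)}
    (hS : (S : Set (Fin n × Fin n)) = dualSupp p.lam) :
    (p.toLabeledPoset hP).IsHighestCoverSet S := by
  have hmem : ∀ x, x ∈ S ↔ x ∈ dualSupp p.lam := fun x => by rw [← hS, Finset.mem_coe]
  refine PosetOn.isHighestCoverSet_of_isGreedy ⟨?_, ?_, fun i k hik hikS => ?_⟩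
  · rw [hS, covers_toLabeledPoset]
    exact p.dualSupp_subset_add
  · rw [hS]
    exact p.isSetPartition
  · rw [covers_toLabeledPoset] at hik
    rw [hmem] at hikS
    rcases ((p.mem_supp_or hik).resolve_left hikS).1 with ⟨_, a, ha, hai⟩ | ⟨_, a, ha, hka⟩
    · exact Or.inr ⟨a, (hmem _).2 ha, hai⟩
    · exact Or.inl ⟨a, (hmem _).2 ha, hka⟩

theorem isRepresentative (hP : P.IsNormal) (p : IndexPair F P) :
    P.IsRepresentative (p.toLabeledPoset hP).toPosetOn := by
  classical
  have hS : ((Set.toFinite (dualSupp p.lam)).toFinset : Set (Fin n × Fin n)) = dualSupp p.lam :=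
    Set.Finite.coe_toFinset _
  refine ⟨fun x hx => chainRel_mem (dualSupp_subset _) hx, _, p.isHighestCoverSet hP hS,
    fun i j k hik hij hjk => ?_, fun i j k hik hjk hij => ?_⟩
  · rw [covers_toLabeledPoset] at hij
    rw [Set.Finite.mem_toFinset] at hik
    rcases p.mem_supp_or hij with h | h
    · exact (p.isSetPartition _ h _ hik fun e =>
        (P.lt_of_mem hjk).ne (Prod.ext_iff.1 e).2).1 rfl
    · exact h.2 (Or.inr ⟨dualSupp_subset _ hij, k, hik, hjk⟩)
  · rw [covers_toLabeledPoset] at hjk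
    rw [Set.Finite.mem_toFinset] at hik
    rcases p.mem_supp_or hjk with h | h
    · exact (p.isSetPartition _ h _ hik fun e =>
        (P.lt_of_mem hij).ne' (Prod.ext_iff.1 e).1).2 rfl
    · exact h.2 (Or.inl ⟨dualSupp_subset _ hjk, i, hik, hij⟩)

/-- Uniqueness of the highest cover set recovers `supp(λ)`; the labels there are those of `λ`, all
others those of `η`. -/
theorem toLabeledPoset_injective (hP : P.IsNormal) :
    Function.Injective fun p : IndexPair F P => p.toLabeledPoset hP := by
  intro p q h
  simp only at h
  have hS := p.isHighestCoverSet hP (Set.Finite.coe_toFinset (Set.toFinite (dualSupp p.lam)))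
  have hT := q.isHighestCoverSet hP (Set.Finite.coe_toFinset (Set.toFinite (dualSupp q.lam)))
  rw [h] at hS
  have hsupp : dualSupp p.lam = dualSupp q.lam := by simpa using hT.unique hS
  have hlab : ∀ i j, entry (p.lam + p.eta) i j = entry (q.lam + q.eta) i j := fun i j =>
    congrFun (congrFun (congrArg LabeledPoset.label h) i) j
  simp only [entry_add] at hlab
  refine IndexPair.ext (dual_ext_entry fun i j => ?_) (dual_ext_entry fun i j => ?_)
  · by_cases hij : (i, j) ∈ dualSupp p.lam
    · simpa [p.entry_eta_of_mem hij, q.entry_eta_of_mem (hsupp ▸ hij)] using hlab i j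
    · rw [p.entry_lam_of_notMem hij, q.entry_lam_of_notMem (hsupp ▸ hij)]
  · by_cases hij : (i, j) ∈ dualSupp p.lam
    · rw [p.entry_eta_of_mem hij, q.entry_eta_of_mem (hsupp ▸ hij)]
    · simpa [p.entry_lam_of_notMem hij, q.entry_lam_of_notMem (hsupp ▸ hij)] using hlab i j

/-- The labels on the highest cover set make up `λ`, the remaining labels `η`. Greediness puts the
remaining covers into `coadj` of the full poset, and the two conditions of representativity keep
them out of `coadj_P`. -/
theorem exists_toLabeledPoset_eq (hP : P.IsNormal) (Q : LabeledPoset n F)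
    (hQ : P.IsRepresentative Q.toPosetOn) : ∃ p : IndexPair F P, p.toLabeledPoset hP = Q := by
  classical
  obtain ⟨hQP, S, hS, h1, h2⟩ := hQ
  have hlab : ∀ i j, Q.label i j ≠ 0 → (i, j) ∈ P.carrier := fun i j h =>
    hQP ((Q.label_ne_zero_iff i j).1 h).1
  have hlam : ∀ i j, entry (dualOfEntries P fun i j => if (i, j) ∈ S then Q.label i j else 0) i j =
      if (i, j) ∈ S then Q.label i j else 0 := by
    refine entry_dualOfEntries_of_support fun i j h => hlab i j ?_
    split_ifs at h with h'
    · exact h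
    · exact absurd rfl h
  have heta : ∀ i j, entry (dualOfEntries P fun i j => if (i, j) ∈ S then 0 else Q.label i j) i j =
      if (i, j) ∈ S then 0 else Q.label i j := by
    refine entry_dualOfEntries_of_support fun i j h => hlab i j ?_
    split_ifs at h with h'
    · exact absurd rfl h
    · exact h
  have hsuppl : dualSupp (dualOfEntries P fun i j => if (i, j) ∈ S then Q.label i j else 0) =
      (S : Set (Fin n × Fin n)) := by
    ext ⟨i, j⟩
    change entry _ i j ≠ 0 ↔ _
    rw [hlam]
    by_cases h : (i, j) ∈ S
    · have : Q.label i j ≠ 0 := (Q.label_ne_zero_iff i j).2 (hS.1 h)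
      simp [h, this]
    · simp [h]
  let p : IndexPair F P :=
    { lam := dualOfEntries P fun i j => if (i, j) ∈ S then Q.label i j else 0
      eta := dualOfEntries P fun i j => if (i, j) ∈ S then 0 else Q.label i j
      isSetPartition := by
        unfold IsSetPartition
        rw [hsuppl]
        exact hS.2.1
      supp_eta := by
        rintro ⟨i, j⟩ hij
        change entry _ i j ≠ 0 at hij
        rw [heta] at hij
        by_cases h : (i, j) ∈ S
        · simp [h] at hij
        · simp only [h, if_false] at hij
          have hijP := hlab i j hij
          have hijC := (Q.label_ne_zero_iff i j).1 hij
          unfold coaux coadjL coadjR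
          rw [hsuppl]
          refine ⟨?_, ?_⟩
          · rcases hS.isGreedy.2.2 i j hijC h with ⟨l, hl, hjl⟩ | ⟨a, ha, hai⟩
            · exact Or.inr ⟨hijP, l, hl, hjl⟩
            · exact Or.inl ⟨hijP, a, ha, hai⟩
          · rintro (⟨_, a, ha, hai⟩ | ⟨_, l, hl, hjl⟩)
            · exact h2 _ _ _ ha hijC hai
            · exact h1 _ _ _ hl hijC hjl }
  have hadd : ∀ i j, entry (p.lam + p.eta) i j = Q.label i j := by
    intro i j
    rw [entry_add]
    change entry (dualOfEntries P fun i j => if (i, j) ∈ S then Q.label i j else 0) i j +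
      entry (dualOfEntries P fun i j => if (i, j) ∈ S then 0 else Q.label i j) i j = _
    rw [hlam, heta]
    split_ifs <;> simp
  have hcov : dualSupp (p.lam + p.eta) = Q.covers := by
    ext ⟨i, j⟩
    change entry _ i j ≠ 0 ↔ _
    rw [hadd]
    exact Q.label_ne_zero_iff i j
  refine ⟨p, LabeledPoset.ext ?_ ?_⟩
  · ext ⟨i, j⟩
    change chainRel (dualSupp (p.lam + p.eta)) i j ↔ _
    rw [hcov]
    exact ⟨fun h => chainRel_mem (fun x hx => hx.1) h, fun h => Q.chainRel_covers h⟩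
  · funext i j
    exact hadd i j

end IndexPair

end DualEntries

/-! ### Lower unitriangular matrices acting on matrices read in `P`. -/

section LowerPattern

open Matrix

variable {n : ℕ} {F : Type*} [Field F] {P : PosetOn n}

theorem PosetOn.IsNormal.mono (hP : P.IsNormal) {a b c d : Fin n} (hab : a ≤ b) (hcd : c ≤ d)
    (h : (b, c) ∈ P.carrier) : (a, d) ∈ P.carrier := by
  by_contra hc
  exact hP a b c d hab (P.lt_of_mem h) hcd hc h

/-- The transpose of `A` lies in `U_P`. -/
def LowerPattern (P : PosetOn n) (A : Matrix (Fin n) (Fin n) F) : Prop :=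
  (∀ i, A i i = 1) ∧ ∀ i j, j ≠ i → A j i ≠ 0 → (i, j) ∈ P.carrier

/-- The transpose of `A` lies in the full unitriangular group. -/
abbrev LowerUnitri (A : Matrix (Fin n) (Fin n) F) : Prop := LowerPattern (PosetOn.full n) A

theorem lowerPattern_iff {A : Matrix (Fin n) (Fin n) F} :
    LowerPattern P A ↔ IsPatternMatrix P Aᵀ := by
  constructor
  · rintro ⟨h1, h2⟩
    refine ⟨h1, fun i j hij => ?_, fun i j hij hP => ?_⟩
    · by_contra hc
      exact lt_asymm hij (P.lt_of_mem (h2 i j hij.ne hc))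
    · by_contra hc
      exact hP (h2 i j hij.ne' hc)
  · rintro ⟨h1, h2, h3⟩
    refine ⟨h1, fun i j hij h => ?_⟩
    rcases hij.lt_or_gt with h' | h'
    · exact absurd (h2 i j h') h
    · by_contra hc
      exact h (h3 i j h' hc)

theorem LowerPattern.full {A : Matrix (Fin n) (Fin n) F} (hA : LowerPattern P A) :
    LowerUnitri A :=
  ⟨hA.1, fun i j hij h => P.lt_of_mem (hA.2 i j hij h)⟩

theorem LowerPattern.one : LowerPattern P (1 : Matrix (Fin n) (Fin n) F) :=
  ⟨fun i => one_apply_eq i, fun _ _ hij h => absurd (one_apply_ne hij) h⟩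

theorem LowerPattern.mul {A B : Matrix (Fin n) (Fin n) F} (hA : LowerPattern P A)
    (hB : LowerPattern P B) : LowerPattern P (A * B) := by
  rw [lowerPattern_iff] at *
  rw [transpose_mul]
  exact hB.mul hA

theorem LowerPattern.transvection {i j : Fin n} (h : (i, j) ∈ P.carrier) (c : F) :
    LowerPattern P (transvection j i c) := by
  have hij := P.lt_of_mem h
  refine ⟨fun a => ?_, fun a b hab hne => ?_⟩
  · have : ¬ (j = a ∧ i = a) := by rintro ⟨rfl, rfl⟩; exact lt_irrefl _ hij
    simp [Matrix.transvection, this]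
  · by_cases hc : j = b ∧ i = a
    · rw [← hc.1, ← hc.2]; exact h
    · simp [Matrix.transvection, hc, one_apply_ne hab] at hne

theorem lowerUnitri_transvection {i j : Fin n} (h : i < j) (c : F) :
    LowerUnitri (transvection j i c) :=
  LowerPattern.transvection (P := PosetOn.full n) h c

theorem LowerUnitri.eq_zero {A : Matrix (Fin n) (Fin n) F} (hA : LowerUnitri A) {i j : Fin n}
    (h : i < j) : A i j = 0 := by
  by_contra hc
  exact lt_asymm h (hA.2 j i h.ne hc)

theorem LowerUnitri.le {A : Matrix (Fin n) (Fin n) F} (hA : LowerUnitri A) {i j : Fin n}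
    (h : A i j ≠ 0) : j ≤ i := by
  by_contra hc
  exact h (hA.eq_zero (not_le.1 hc))

theorem IsPatternMatrix.exists_patternGroup [Finite F] {g : Matrix (Fin n) (Fin n) F}
    (hg : IsPatternMatrix P g) :
    ∃ u : patternGroup F P, ((u : GL (Fin n) F) : Matrix (Fin n) (Fin n) F) = g := by
  have hdet : g.det = 1 := by
    rw [det_of_isUpperTriangular]
    · simp [hg.1]
    · intro i j hij
      exact hg.2.1 i j hij
  exact ⟨⟨GeneralLinearGroup.mk'' g (by rw [hdet]; exact isUnit_one), hg⟩, rfl⟩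

theorem LowerPattern.exists_inv [Finite F] {A : Matrix (Fin n) (Fin n) F}
    (hA : LowerPattern P A) : ∃ B, LowerPattern P B ∧ A * B = 1 ∧ B * A = 1 := by
  obtain ⟨u, hu⟩ := (lowerPattern_iff.1 hA).exists_patternGroup
  refine ⟨(((u⁻¹ : patternGroup F P) : GL (Fin n) F) : Matrix (Fin n) (Fin n) F)ᵀ,
    lowerPattern_iff.2 (by rw [transpose_transpose]; exact u⁻¹.2), ?_, ?_⟩
  all_goals
    apply transpose_injective
    rw [transpose_mul, transpose_transpose, ← hu, ← Units.val_mul, ← Subgroup.coe_mul]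
    simp

/-- Matrices supported in the transpose of `P`. -/
def LowerNil (P : PosetOn n) (X : Matrix (Fin n) (Fin n) F) : Prop :=
  ∀ i j, X j i ≠ 0 → (i, j) ∈ P.carrier

theorem lowerPattern_iff_sub_one {A : Matrix (Fin n) (Fin n) F} :
    LowerPattern P A ↔ LowerNil P (A - 1) := by
  rw [lowerPattern_iff, isPatternMatrix_iff]
  have : Aᵀ - 1 = (A - 1)ᵀ := by simp
  rw [this]
  exact Iff.rfl

/-- Lower multiplication moves entries down and to the left, and normality keeps the transposed
positions in `P`. Thus the transposed `𝔫_P` is stable under full unitriangular factors, and `U_P` is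
normalized by them. -/
theorem LowerNil.mul_left (hP : P.IsNormal) {G X : Matrix (Fin n) (Fin n) F} (hG : LowerUnitri G)
    (hX : LowerNil P X) : LowerNil P (G * X) := by
  intro i j h
  rw [mul_apply] at h
  obtain ⟨m, -, hm⟩ := Finset.exists_ne_zero_of_sum_ne_zero h
  exact hP.mono le_rfl (hG.le (left_ne_zero_of_mul hm)) (hX i m (right_ne_zero_of_mul hm))

theorem LowerNil.mul_right (hP : P.IsNormal) {G X : Matrix (Fin n) (Fin n) F} (hG : LowerUnitri G)
    (hX : LowerNil P X) : LowerNil P (X * G) := by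
  intro i j h
  rw [mul_apply] at h
  obtain ⟨m, -, hm⟩ := Finset.exists_ne_zero_of_sum_ne_zero h
  exact hP.mono (hG.le (right_ne_zero_of_mul hm)) le_rfl (hX m j (left_ne_zero_of_mul hm))

theorem LowerPattern.mul_eq_mul_left [Finite F] (hP : P.IsNormal) {G A : Matrix (Fin n) (Fin n) F}
    (hA : LowerPattern P A) (hG : LowerUnitri G) : ∃ B, LowerPattern P B ∧ G * A = B * G := by
  obtain ⟨K, hK, hGK, hKG⟩ := hG.exists_inv
  refine ⟨G * A * K, ?_, by rw [mul_assoc (G * A), hKG, mul_one]⟩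
  rw [lowerPattern_iff_sub_one] at hA ⊢
  have : G * A * K - 1 = G * (A - 1) * K := by rw [mul_sub, sub_mul, mul_one, hGK]
  rw [this]
  exact (hA.mul_left hP hG).mul_right hP hK

theorem LowerPattern.mul_eq_mul_right [Finite F] (hP : P.IsNormal) {G A : Matrix (Fin n) (Fin n) F}
    (hA : LowerPattern P A) (hG : LowerUnitri G) : ∃ B, LowerPattern P B ∧ A * G = G * B := by
  obtain ⟨K, hK, hGK, hKG⟩ := hG.exists_inv
  obtain ⟨B, hB, h⟩ := hA.mul_eq_mul_left hP hK
  exact ⟨B, hB, by rw [← mul_one B, ← hKG, ← mul_assoc B, ← h, ← mul_assoc, ← mul_assoc, hGK,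
    one_mul]⟩

theorem LowerPattern.mul_apply_of_notMem (hP : P.IsNormal) {G A : Matrix (Fin n) (Fin n) F}
    (hA : LowerPattern P A) (hG : LowerUnitri G) {i j : Fin n} (h : (i, j) ∉ P.carrier) :
    (G * A) j i = G j i := by
  have h1 := (lowerPattern_iff_sub_one.1 hA).mul_left hP hG
  have h2 : (G * (A - 1)) j i = 0 := by
    by_contra hc
    exact h (h1 i j hc)
  rw [mul_sub, mul_one, Matrix.sub_apply] at h2
  exact sub_eq_zero.1 h2

/-- Equality of the entries in the positions of `P`. -/
def EqOnPositions (P : PosetOn n) (X Y : Matrix (Fin n) (Fin n) F) : Prop :=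
  ∀ i k, (i, k) ∈ P.carrier → X i k = Y i k

/-- The entry of `G * X * H` at `(i, k)` involves only entries of `X` at `(j, l)` with `j ≤ i` and
`k ≤ l`. By normality these positions lie in `P` whenever `(i, k)` does. -/
theorem EqOnPositions.mul_mul (hP : P.IsNormal) {X Y G H : Matrix (Fin n) (Fin n) F}
    (h : EqOnPositions P X Y) (hG : LowerUnitri G) (hH : LowerUnitri H) :
    EqOnPositions P (G * X * H) (G * Y * H) := by
  have h1 : EqOnPositions P (G * X) (G * Y) := by
    intro i k hik
    rw [mul_apply, mul_apply]
    refine Finset.sum_congr rfl fun j _ => ?_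
    by_cases hj : G i j = 0
    · rw [hj, zero_mul, zero_mul]
    · rw [h j k (hP.mono (hG.le hj) le_rfl hik)]
  intro i k hik
  rw [mul_apply, mul_apply]
  refine Finset.sum_congr rfl fun j _ => ?_
  by_cases hj : H j k = 0
  · rw [hj, mul_zero, mul_zero]
  · rw [h1 i j (hP.mono le_rfl (hH.le hj) hik)]

/-- `Y` arises from `X`, up to entries outside of `P`, by the two-sided action of `U_P`. -/
def PatternEquiv (P : PosetOn n) (X Y : Matrix (Fin n) (Fin n) F) : Prop :=
  ∃ A B, LowerPattern P A ∧ LowerPattern P B ∧ EqOnPositions P (A * X * B) Y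

theorem EqOnPositions.patternEquiv {X Y : Matrix (Fin n) (Fin n) F} (h : EqOnPositions P X Y) :
    PatternEquiv P X Y :=
  ⟨1, 1, LowerPattern.one, LowerPattern.one, by simpa using h⟩

theorem PatternEquiv.refl (X : Matrix (Fin n) (Fin n) F) : PatternEquiv P X X :=
  EqOnPositions.patternEquiv fun _ _ _ => rfl

theorem PatternEquiv.trans (hP : P.IsNormal) {X Y Z : Matrix (Fin n) (Fin n) F}
    (h : PatternEquiv P X Y) (h' : PatternEquiv P Y Z) : PatternEquiv P X Z := by
  obtain ⟨A, B, hA, hB, h⟩ := h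
  obtain ⟨A', B', hA', hB', h'⟩ := h'
  refine ⟨A' * A, B * B', hA'.mul hA, hB.mul hB', fun i k hik => ?_⟩
  rw [← h' i k hik, ← h.mul_mul hP hA'.full hB'.full i k hik]
  simp only [mul_assoc]

theorem PatternEquiv.symm [Finite F] (hP : P.IsNormal) {X Y : Matrix (Fin n) (Fin n) F}
    (h : PatternEquiv P X Y) : PatternEquiv P Y X := by
  obtain ⟨A, B, hA, hB, h⟩ := h
  obtain ⟨A', hA', -, h1⟩ := hA.exists_inv
  obtain ⟨B', hB', h2, -⟩ := hB.exists_inv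
  refine ⟨A', B', hA', hB', fun i k hik => ?_⟩
  rw [← h.mul_mul hP hA'.full hB'.full i k hik, ← mul_assoc, ← mul_assoc, h1, one_mul, mul_assoc,
    h2, mul_one]

theorem PatternEquiv.mul_mul [Finite F] (hP : P.IsNormal) {X Y G H : Matrix (Fin n) (Fin n) F}
    (h : PatternEquiv P X Y) (hG : LowerUnitri G) (hH : LowerUnitri H) :
    PatternEquiv P (G * X * H) (G * Y * H) := by
  obtain ⟨A, B, hA, hB, h⟩ := h
  obtain ⟨A', hA', h1⟩ := hA.mul_eq_mul_left hP hG
  obtain ⟨B', hB', h2⟩ := hB.mul_eq_mul_right hP hH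
  refine ⟨A', B', hA', hB', fun i k hik => ?_⟩
  rw [← h.mul_mul hP hG hH i k hik]
  refine congrFun (congrFun ?_ i) k
  calc A' * (G * X * H) * B' = A' * G * X * (H * B') := by simp only [mul_assoc]
    _ = G * A * X * (B * H) := by rw [h1, h2]
    _ = G * (A * X * B) * H := by simp only [mul_assoc]

/-! ### Bruhat decomposition and factorization of unitriangular matrices. -/

/-- Encodes the lexicographic order of positions in `ℕ`, so that eliminations can run by induction
on a bound `m` for the positions already treated. -/
theorem Fin.mul_add_lt_iff (a b c d : Fin n) :
    (a : ℕ) * n + b < c * n + d ↔ a < c ∨ a = c ∧ b < d := by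
  constructor
  · intro h
    rcases lt_trichotomy a c with hac | rfl | hac
    · exact Or.inl hac
    · exact Or.inr ⟨rfl, by rw [Fin.lt_def]; omega⟩
    · have : (c : ℕ) + 1 ≤ a := hac
      nlinarith [d.2, b.2]
  · rintro (h | ⟨rfl, h⟩)
    · have : (a : ℕ) + 1 ≤ c := h
      nlinarith [d.2, b.2]
    · rw [Fin.lt_def] at h
      omega

theorem Fin.mul_add_lt_mul (a b : Fin n) : (a : ℕ) * n + b < n * n := by
  have : (a : ℕ) + 1 ≤ n := a.2
  nlinarith [b.2]

theorem IndependentPositions.mono {S T : Set (Fin n × Fin n)} (hT : IndependentPositions T)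
    (h : S ⊆ T) : IndependentPositions S :=
  fun p hp q hq hne => hT p (h hp) q (h hq) hne

/-- Bruhat decomposition: each matrix is the product of a lower unitriangular matrix, a matrix with
at most one nonzero entry in each row and column, and a lower unitriangular matrix. -/
theorem exists_bruhat (M : Matrix (Fin n) (Fin n) F) :
    ∃ G H L : Matrix (Fin n) (Fin n) F, LowerUnitri G ∧ LowerUnitri H ∧ M = G * L * H ∧
      IndependentPositions {p : Fin n × Fin n | L p.1 p.2 ≠ 0} := by
  -- Rows are treated from top to bottom, each from right to left (hence `rev`), so that clearing by
  -- pivots above or to the right uses lower unitriangular factors.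
  have key : ∀ m : ℕ, ∃ G H L : Matrix (Fin n) (Fin n) F, LowerUnitri G ∧ LowerUnitri H ∧
      M = G * L * H ∧ IndependentPositions
        {p : Fin n × Fin n | L p.1 p.2 ≠ 0 ∧ (p.1 : ℕ) * n + p.2.rev < m} := by
    intro m
    induction m with
    | zero =>
      exact ⟨1, 1, M, LowerPattern.one, LowerPattern.one, by simp, by simp [IndependentPositions]⟩
    | succ m ih =>
      obtain ⟨G, H, L, hG, hH, hM, hL⟩ := ih
      by_cases hm : ∃ i k : Fin n, (i : ℕ) * n + k.rev = m ∧ L i k ≠ 0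
      swap
      · refine ⟨G, H, L, hG, hH, hM, hL.mono ?_⟩
        rintro ⟨a, b⟩ ⟨h1, h2⟩
        exact ⟨h1, lt_of_le_of_ne (Nat.le_of_lt_succ h2) fun h => hm ⟨a, b, h, h1⟩⟩
      obtain ⟨i, k, rfl, hik⟩ := hm
      have hlt : ∀ a b : Fin n, (a : ℕ) * n + b.rev < i * n + k.rev ↔ a < i ∨ a = i ∧ k < b := by
        intro a b
        rw [Fin.mul_add_lt_iff, Fin.rev_lt_rev]
      have hle : ∀ a b : Fin n, (a : ℕ) * n + b.rev < i * n + k.rev + 1 ↔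
          a < i ∨ a = i ∧ k ≤ b := by
        intro a b
        rw [Nat.lt_succ_iff, ← not_lt, Fin.mul_add_lt_iff, Fin.rev_lt_rev]
        constructor
        · intro h
          rcases lt_trichotomy a i with h' | h' | h'
          · exact Or.inl h'
          · exact Or.inr ⟨h', not_lt.1 fun h'' => h (Or.inr ⟨h'.symm, h''⟩)⟩
          · exact absurd (Or.inl h') h
        · rintro (h | ⟨rfl, h⟩) (h' | ⟨h', h''⟩)
          · exact lt_asymm h h'
          · exact h.ne h'.symm
          · exact lt_irrefl _ h'
          · exact absurd h'' (not_lt.2 h)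
      have hsub : ∀ L' : Matrix (Fin n) (Fin n) F, L' i k = 0 →
          (∀ a b, (a < i ∨ a = i ∧ k < b) → L' a b = L a b) →
          IndependentPositions {p : Fin n × Fin n | L' p.1 p.2 ≠ 0 ∧
            (p.1 : ℕ) * n + p.2.rev < i * n + k.rev + 1} := by
        intro L' h0 heq
        refine hL.mono ?_
        rintro ⟨a, b⟩ ⟨h1, h2⟩
        simp only at h1 h2
        have : a < i ∨ a = i ∧ k < b := by
          rcases (hle a b).1 h2 with h | ⟨rfl, h⟩
          · exact Or.inl h
          · refine Or.inr ⟨rfl, lt_of_le_of_ne h ?_⟩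
            rintro rfl
            exact h1 h0
        exact ⟨by rwa [heq a b this] at h1, (hlt a b).2 this⟩
      -- A pivot above: its row is completely treated, hence zero elsewhere, and subtracting it
      -- disturbs no treated entry.
      by_cases h1 : ∃ i', i' < i ∧ L i' k ≠ 0
      · obtain ⟨i', hi', hL'⟩ := h1
        refine ⟨G * transvection i i' (L i k / L i' k), H,
          transvection i i' (-(L i k / L i' k)) * L,
          hG.mul (lowerUnitri_transvection hi' _), hH, ?_, ?_⟩
        · rw [mul_assoc G, ← mul_assoc (transvection _ _ _),
            transvection_mul_transvection_same _ _ hi'.ne', add_neg_cancel, transvection_zero,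
            one_mul, hM]
        · refine hsub _ ?_ fun a b hab => ?_
          · rw [transvection_mul_apply_same]
            field_simp
            ring
          · rcases hab with hab | ⟨rfl, hab⟩
            · rw [transvection_mul_apply_of_ne _ _ _ _ hab.ne]
            · have : L i' b = 0 := by
                by_contra hc
                exact (hL (i', b) ⟨hc, (hlt _ _).2 (Or.inl hi')⟩ (i', k)
                  ⟨hL', (hlt _ _).2 (Or.inl hi')⟩ fun e => hab.ne' (Prod.ext_iff.1 e).2).1 rfl
              rw [transvection_mul_apply_same, this, mul_zero, add_zero]
      -- A pivot to the right: its column vanishes above row `i`, so the column operation disturbs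
      -- no treated entry.
      · by_cases h2 : ∃ l, k < l ∧ L i l ≠ 0
        · obtain ⟨l, hl, hL'⟩ := h2
          refine ⟨G, transvection l k (L i k / L i l) * H,
            L * transvection l k (-(L i k / L i l)),
            hG, (lowerUnitri_transvection hl _).mul hH, ?_, ?_⟩
          · rw [← mul_assoc G, mul_assoc _ _ (_ * H), ← mul_assoc (transvection _ _ _),
              transvection_mul_transvection_same _ _ hl.ne', neg_add_cancel, transvection_zero,
              one_mul, hM]
          · refine hsub _ ?_ fun a b hab => ?_
            · rw [mul_transvection_apply_same]
              field_simp
              ring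
            · by_cases hb : b = k
              · subst hb
                rcases hab with hab | ⟨-, hab⟩
                · have : L a l = 0 := by
                    by_contra hc
                    exact (hL (a, l) ⟨hc, (hlt _ _).2 (Or.inl hab)⟩ (i, l)
                      ⟨hL', (hlt _ _).2 (Or.inr ⟨rfl, hl⟩)⟩
                      fun e => hab.ne (Prod.ext_iff.1 e).1).2 rfl
                  rw [mul_transvection_apply_same, this, mul_zero, add_zero]
                · exact absurd hab (lt_irrefl _)
              · rw [mul_transvection_apply_of_ne _ _ _ _ hb]
        -- Otherwise `(i, k)` is itself a new pivot.
        · push Not at h1 h2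
          refine ⟨G, H, L, hG, hH, hM, ?_⟩
          have hconf : ∀ a b : Fin n, L a b ≠ 0 → (a : ℕ) * n + b.rev < i * n + k.rev →
              i ≠ a ∧ k ≠ b := by
            intro a b hab hlt'
            rcases (hlt a b).1 hlt' with h | ⟨rfl, h⟩
            · refine ⟨h.ne', ?_⟩
              rintro rfl
              exact hab (h1 a h)
            · exact absurd (h2 b h) hab
          have hcase : ∀ p : Fin n × Fin n, (p.1 : ℕ) * n + p.2.rev < i * n + k.rev + 1 →
              p = (i, k) ∨ (p.1 : ℕ) * n + p.2.rev < i * n + k.rev := by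
            rintro ⟨a, b⟩ h
            rw [hlt]
            rcases (hle a b).1 h with h' | ⟨rfl, h'⟩
            · exact Or.inr (Or.inl h')
            · rcases h'.eq_or_lt with rfl | h'
              · exact Or.inl rfl
              · exact Or.inr (Or.inr ⟨rfl, h'⟩)
          rintro p ⟨hp, hp'⟩ q ⟨hq, hq'⟩ hne
          rcases hcase p hp' with rfl | hp' <;> rcases hcase q hq' with rfl | hq'
          · exact absurd rfl hne
          · exact hconf _ _ hq hq'
          · exact (hconf _ _ hp hp').imp Ne.symm Ne.symm
          · exact hL p ⟨hp, hp'⟩ q ⟨hq, hq'⟩ hne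
  obtain ⟨G, H, L, hG, hH, hM, hL⟩ := key (n * n)
  exact ⟨G, H, L, hG, hH, hM, hL.mono fun p hp => ⟨hp, Fin.mul_add_lt_mul _ _⟩⟩

/-- Factor a lower unitriangular matrix as one whose off-diagonal support lies in `T` times an
element of the monoid `K`, if `K` contains the elementary matrices outside of `T`. -/
theorem LowerUnitri.exists_eq_mul_right {G : Matrix (Fin n) (Fin n) F} (hG : LowerUnitri G)
    (T : Set (Fin n × Fin n)) (K : Submonoid (Matrix (Fin n) (Fin n) F))
    (hK : ∀ i j c, i < j → (j, i) ∉ T → transvection j i c ∈ K) :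
    ∃ A κ, LowerUnitri A ∧ (∀ i j, i < j → A j i ≠ 0 → (j, i) ∈ T) ∧ κ ∈ K ∧ G = A * κ := by
  -- Column `j` of `A` vanishes above its diagonal entry `1`. Adding a multiple of it to column `i`
  -- therefore changes only `(j, i)` among the rows up to `j`, and rows can be treated from the top.
  have key : ∀ m : ℕ, ∃ A κ, LowerUnitri A ∧ (∀ i j : Fin n, i < j → (j : ℕ) * n + i < m →
      A j i ≠ 0 → (j, i) ∈ T) ∧ κ ∈ K ∧ G = A * κ := by
    intro m
    induction m with
    | zero => exact ⟨G, 1, hG, fun i j _ h => absurd h (Nat.not_lt_zero _), K.one_mem, by simp⟩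
    | succ m ih =>
      obtain ⟨A, κ, hA, hT, hκ, hGA⟩ := ih
      by_cases hm : ∃ i j : Fin n, (j : ℕ) * n + i = m ∧ i < j ∧ (j, i) ∉ T
      swap
      · refine ⟨A, κ, hA, fun i j hij hlt h => ?_, hκ, hGA⟩
        rcases (Nat.le_of_lt_succ hlt).lt_or_eq with h' | h'
        · exact hT i j hij h' h
        · by_contra hc
          exact hm ⟨i, j, h', hij, hc⟩
      obtain ⟨i, j, rfl, hij, hijT⟩ := hm
      refine ⟨A * transvection j i (-A j i), transvection j i (A j i) * κ,
        hA.mul (lowerUnitri_transvection hij _), fun a b hab hlt hne => ?_,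
        K.mul_mem (hK i j _ hij hijT) hκ, ?_⟩
      · rcases (Nat.le_of_lt_succ hlt).lt_or_eq with h' | h'
        · refine hT a b hab h' ?_
          by_cases hai : a = i
          · subst hai
            have hbj : b < j := by
              rcases (Fin.mul_add_lt_iff b a j a).1 h' with h | ⟨-, h⟩
              · exact h
              · exact absurd h (lt_irrefl _)
            rwa [mul_transvection_apply_same, hA.eq_zero hbj, mul_zero, add_zero] at hne
          · rwa [mul_transvection_apply_of_ne _ _ _ _ hai] at hne
        · have hb : b = j := by
            rcases lt_trichotomy b j with h | h | h
            · exact absurd ((Fin.mul_add_lt_iff b a j i).2 (Or.inl h)) h'.not_lt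
            · exact h
            · exact absurd ((Fin.mul_add_lt_iff j i b a).2 (Or.inl h)) h'.not_gt
          subst hb
          have ha : a = i := Fin.ext (by omega)
          subst ha
          rw [mul_transvection_apply_same, hA.1, mul_one, add_neg_cancel] at hne
          exact absurd rfl hne
      · rw [mul_assoc A, ← mul_assoc (transvection _ _ _),
          transvection_mul_transvection_same _ _ hij.ne', neg_add_cancel, transvection_zero,
          one_mul, hGA]
  obtain ⟨A, κ, hA, hT, hκ, h⟩ := key (n * n)
  exact ⟨A, κ, hA, fun i j hij => hT i j hij (Fin.mul_add_lt_mul _ _), hκ, h⟩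

/-- Factor a lower unitriangular matrix as an element of the monoid `K` times one whose
off-diagonal support lies in `T`, if `K` contains the elementary matrices outside of `T`. -/
theorem LowerUnitri.exists_eq_mul_left {G : Matrix (Fin n) (Fin n) F} (hG : LowerUnitri G)
    (T : Set (Fin n × Fin n)) (K : Submonoid (Matrix (Fin n) (Fin n) F))
    (hK : ∀ k l c, k < l → (l, k) ∉ T → transvection l k c ∈ K) :
    ∃ B κ, LowerUnitri B ∧ (∀ k l, k < l → B l k ≠ 0 → (l, k) ∈ T) ∧ κ ∈ K ∧ G = κ * B := by
  -- Row `k` of `B` vanishes to the right of the diagonal, so here columns are treated from the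
  -- right.
  have key : ∀ m : ℕ, ∃ B κ, LowerUnitri B ∧ (∀ k l : Fin n, k < l → (k.rev : ℕ) * n + l < m →
      B l k ≠ 0 → (l, k) ∈ T) ∧ κ ∈ K ∧ G = κ * B := by
    intro m
    induction m with
    | zero => exact ⟨G, 1, hG, fun i j _ h => absurd h (Nat.not_lt_zero _), K.one_mem, by simp⟩
    | succ m ih =>
      obtain ⟨B, κ, hB, hT, hκ, hGB⟩ := ih
      by_cases hm : ∃ k l : Fin n, (k.rev : ℕ) * n + l = m ∧ k < l ∧ (l, k) ∉ T
      swap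
      · refine ⟨B, κ, hB, fun k l hkl hlt h => ?_, hκ, hGB⟩
        rcases (Nat.le_of_lt_succ hlt).lt_or_eq with h' | h'
        · exact hT k l hkl h' h
        · by_contra hc
          exact hm ⟨k, l, h', hkl, hc⟩
      obtain ⟨k, l, rfl, hkl, hklT⟩ := hm
      refine ⟨transvection l k (-B l k) * B, κ * transvection l k (B l k),
        (lowerUnitri_transvection hkl _).mul hB, fun a b hab hlt hne => ?_,
        K.mul_mem hκ (hK k l _ hkl hklT), ?_⟩
      · rcases (Nat.le_of_lt_succ hlt).lt_or_eq with h' | h'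
        · refine hT a b hab h' ?_
          by_cases hbl : b = l
          · subst hbl
            have hka : k < a := by
              rcases (Fin.mul_add_lt_iff a.rev b k.rev b).1 h' with h | ⟨-, h⟩
              · exact Fin.rev_lt_rev.1 h
              · exact absurd h (lt_irrefl _)
            rwa [transvection_mul_apply_same, hB.eq_zero hka, mul_zero, add_zero] at hne
          · rwa [transvection_mul_apply_of_ne _ _ _ _ hbl] at hne
        · have ha : a.rev = k.rev := by
            rcases lt_trichotomy a.rev k.rev with h | h | h
            · exact absurd ((Fin.mul_add_lt_iff a.rev b k.rev l).2 (Or.inl h)) h'.not_lt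
            · exact h
            · exact absurd ((Fin.mul_add_lt_iff k.rev l a.rev b).2 (Or.inl h)) h'.not_gt
          have ha := Fin.rev_injective ha
          subst ha
          have hb : b = l := Fin.ext (by omega)
          subst hb
          rw [transvection_mul_apply_same, hB.1, mul_one, add_neg_cancel] at hne
          exact absurd rfl hne
      · rw [← mul_assoc, mul_assoc κ, transvection_mul_transvection_same _ _ hkl.ne',
          add_neg_cancel, transvection_zero, mul_one, hGB]
  obtain ⟨B, κ, hB, hT, hκ, h⟩ := key (n * n)
  exact ⟨B, κ, hB, fun i j hij => hT i j hij (Fin.mul_add_lt_mul _ _), hκ, h⟩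

end LowerPattern

/-! ### Normal forms of two-sided orbits: existence and uniqueness. -/

section NormalForm

open Matrix

variable {n : ℕ} {F : Type*} [Field F] {P : PosetOn n}

/-- At most one nonzero entry in each row and column. -/
def IsPartialMonomial (L : Matrix (Fin n) (Fin n) F) : Prop :=
  IndependentPositions {p : Fin n × Fin n | L p.1 p.2 ≠ 0}

namespace IsPartialMonomial

variable {L : Matrix (Fin n) (Fin n) F}

theorem row_eq (hL : IsPartialMonomial L) {i j k : Fin n} (h : L i k ≠ 0) (h' : L j k ≠ 0) :
    i = j := by
  by_contra hc
  exact (hL (i, k) h (j, k) h' fun e => hc (Prod.ext_iff.1 e).1).2 rfl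

theorem col_eq (hL : IsPartialMonomial L) {i k l : Fin n} (h : L i k ≠ 0) (h' : L i l ≠ 0) :
    k = l := by
  by_contra hc
  exact (hL (i, k) h (i, l) h' fun e => hc (Prod.ext_iff.1 e).2).1 rfl

theorem mul_apply_left (hL : IsPartialMonomial L) {i k : Fin n} (h : L i k ≠ 0)
    (X : Matrix (Fin n) (Fin n) F) (a : Fin n) :
    (X * L) a k = X a i * L i k := by
  rw [mul_apply, Finset.sum_eq_single i _ (by simp)]
  intro j _ hj
  have : L j k = 0 := by
    by_contra hc
    exact hj (hL.row_eq hc h)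
  rw [this, mul_zero]

theorem mul_apply_right (hL : IsPartialMonomial L) {i k : Fin n} (h : L i k ≠ 0)
    (X : Matrix (Fin n) (Fin n) F) (a : Fin n) :
    (L * X) i a = L i k * X k a := by
  rw [mul_apply, Finset.sum_eq_single k _ (by simp)]
  intro j _ hj
  have : L i j = 0 := by
    by_contra hc
    exact hj (hL.col_eq hc h)
  rw [this, zero_mul]

/-- Both products add to `L` the single entry `c * L i k` at `(j, k)`. This transports a row
operation between pivot rows into a column operation between pivot columns. -/
theorem transvection_mul (hL : IsPartialMonomial L) {i j k l : Fin n} (hik : L i k ≠ 0)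
    (hjl : L j l ≠ 0) (c : F) :
    transvection j i c * L = L * transvection l k (c * L i k / L j l) := by
  unfold transvection
  rw [add_mul, mul_add, one_mul, mul_one]
  congr 1
  ext a b
  by_cases ha : a = j
  · subst ha
    rw [single_mul_apply_same, hL.mul_apply_right hjl]
    by_cases hb : b = k
    · subst hb
      rw [single_apply_same]
      field_simp
    · have h0 : L i b = 0 := by
        by_contra hc
        exact hb (hL.col_eq hc hik)
      rw [h0, single_apply_of_ne _ _ _ _ _ (fun h => hb h.2.symm), mul_zero, mul_zero]
  · rw [single_mul_apply_of_ne _ _ _ _ _ ha]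
    by_cases hb : b = k
    · subst hb
      have h0 : L a l = 0 := by
        by_contra hc
        exact ha (hL.row_eq hc hjl)
      rw [mul_single_apply_same, h0, zero_mul]
    · rw [mul_single_apply_of_ne _ _ _ _ _ hb]

end IsPartialMonomial

/-- The positions below the diagonal remaining in a left factor of `L` modulo the stabilizer of
the `U_P`-orbit of `L`. -/
def leftFree (P : PosetOn n) (L : Matrix (Fin n) (Fin n) F) : Set (Fin n × Fin n) :=
  {p | ∃ k, L p.2 k ≠ 0 ∧ (p.2, p.1) ∉ P.carrier ∧ (p.1, k) ∈ P.carrier ∧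
    ∀ l, L p.1 l ≠ 0 → (k, l) ∉ P.carrier}

/-- The positions below the diagonal remaining in a right factor of `L` modulo the actions of
`U_P` and of left factors. -/
def rightFree (P : PosetOn n) (L : Matrix (Fin n) (Fin n) F) : Set (Fin n × Fin n) :=
  {p | ∃ j, L j p.1 ≠ 0 ∧ (p.2, p.1) ∉ P.carrier ∧ (j, p.2) ∈ P.carrier ∧
    ∀ i, i < j → L i p.2 = 0}

theorem exists_bruhat_supported (P : PosetOn n) (hP : P.IsNormal)
    (M : Matrix (Fin n) (Fin n) F) :
    ∃ G H L : Matrix (Fin n) (Fin n) F, LowerUnitri G ∧ LowerUnitri H ∧ IsPartialMonomial L ∧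
      (∀ i k, L i k ≠ 0 → (i, k) ∈ P.carrier) ∧ EqOnPositions P M (G * L * H) := by
  classical
  obtain ⟨G, H, L, hG, hH, hM, hL⟩ := exists_bruhat M
  refine ⟨G, H, fun i k => if (i, k) ∈ P.carrier then L i k else 0, hG, hH, hL.mono ?_, ?_, ?_⟩
  · rintro ⟨i, k⟩ h
    simp only [Set.mem_ofPred_eq] at h ⊢
    split_ifs at h
    · exact h
    · exact absurd rfl h
  · intro i k h
    by_contra hc
    simp [hc] at h
  · rw [hM]
    refine EqOnPositions.mul_mul hP (fun i k hik => ?_) hG hH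
    simp [hik]

/-- Outside `leftFree` one of three things happens: the row operation belongs to `U_P`, or `L`
transports it to a column operation of `U_P`, or it changes `L` only outside `P`. -/
theorem patternEquiv_transvection_mul {L : Matrix (Fin n) (Fin n) F} (hL : IsPartialMonomial L)
    {i j : Fin n} (hij : (j, i) ∉ leftFree P L) (c : F) :
    PatternEquiv P (transvection j i c * L) L := by
  by_cases h1 : (i, j) ∈ P.carrier
  · refine ⟨transvection j i (-c), 1, LowerPattern.transvection h1 _, LowerPattern.one,
      fun a b _ => ?_⟩
    rw [← mul_assoc, transvection_mul_transvection_same _ _ (P.lt_of_mem h1).ne', neg_add_cancel,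
      transvection_zero, one_mul, mul_one]
  by_cases h2 : ∃ k, L i k ≠ 0 ∧ (j, k) ∈ P.carrier
  · obtain ⟨k, hik, hjk⟩ := h2
    have h3 : ∃ l, L j l ≠ 0 ∧ (k, l) ∈ P.carrier := by
      by_contra! hc
      exact hij ⟨k, hik, h1, hjk, hc⟩
    obtain ⟨l, hjl, hkl⟩ := h3
    rw [hL.transvection_mul hik hjl]
    refine ⟨1, transvection l k (-(c * L i k / L j l)), LowerPattern.one,
      LowerPattern.transvection hkl _, fun a b _ => ?_⟩
    rw [one_mul, mul_assoc, transvection_mul_transvection_same _ _ (P.lt_of_mem hkl).ne',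
      add_neg_cancel, transvection_zero, mul_one]
  · push Not at h2
    refine EqOnPositions.patternEquiv fun a b hab => ?_
    by_cases haj : a = j
    · subst haj
      have : L i b = 0 := by
        by_contra hc
        exact h2 b hc hab
      rw [transvection_mul_apply_same, this, mul_zero, add_zero]
    · rw [transvection_mul_apply_of_ne _ _ _ _ haj]

/-- As for rows, except that a transported operation need not lie in `U_P`: it is kept as the left
factor `g`. -/
theorem patternEquiv_mul_transvection {L : Matrix (Fin n) (Fin n) F} (hL : IsPartialMonomial L)
    {k l : Fin n} (hkl : (l, k) ∉ rightFree P L) (c : F) :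
    ∃ g, LowerUnitri g ∧ PatternEquiv P (L * transvection l k c) (g * L) := by
  by_cases h1 : (k, l) ∈ P.carrier
  · refine ⟨1, LowerPattern.one, 1, transvection l k (-c), LowerPattern.one,
      LowerPattern.transvection h1 _, fun a b _ => ?_⟩
    rw [one_mul, one_mul, mul_assoc,
      transvection_mul_transvection_same _ _ (P.lt_of_mem h1).ne', add_neg_cancel,
      transvection_zero, mul_one]
  by_cases h2 : ∃ j, L j l ≠ 0 ∧ (j, k) ∈ P.carrier
  · obtain ⟨j, hjl, hjk⟩ := h2
    have h3 : ∃ i, i < j ∧ L i k ≠ 0 := by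
      by_contra! hc
      exact hkl ⟨j, hjl, h1, hjk, hc⟩
    obtain ⟨i, hij, hik⟩ := h3
    refine ⟨transvection j i (c * L j l / L i k), lowerUnitri_transvection hij _, ?_⟩
    rw [hL.transvection_mul hik hjl]
    have : c * L j l / L i k * L i k / L j l = c := by field_simp
    rw [this]
    exact PatternEquiv.refl _
  · push Not at h2
    refine ⟨1, LowerPattern.one, EqOnPositions.patternEquiv fun a b hab => ?_⟩
    rw [one_mul]
    by_cases hbk : b = k
    · subst hbk
      have : L a l = 0 := by
        by_contra hc
        exact h2 a hc hab
      rw [mul_transvection_apply_same, this, mul_zero, add_zero]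
    · rw [mul_transvection_apply_of_ne _ _ _ _ hbk]

theorem exists_patternEquiv_normalForm [Finite F] (hP : P.IsNormal)
    (M : Matrix (Fin n) (Fin n) F) :
    ∃ L A B : Matrix (Fin n) (Fin n) F, IsPartialMonomial L ∧
      (∀ i k, L i k ≠ 0 → (i, k) ∈ P.carrier) ∧
      LowerUnitri A ∧ (∀ i j, i < j → A j i ≠ 0 → (j, i) ∈ leftFree P L) ∧
      LowerUnitri B ∧ (∀ k l, k < l → B l k ≠ 0 → (l, k) ∈ rightFree P L) ∧
      PatternEquiv P M (A * L * B) := by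
  obtain ⟨G, H, L, hG, hH, hL, hLP, hM⟩ := exists_bruhat_supported P hP M
  -- The right factor is reduced first and its surplus is pushed through `L` into the left factor,
  -- which is reduced afterwards. This is why the overlap of `coauxL` and `coauxR` is assigned to
  -- `η_L`.
  let KB : Submonoid (Matrix (Fin n) (Fin n) F) :=
    { carrier := {κ | LowerUnitri κ ∧ ∃ g, LowerUnitri g ∧ PatternEquiv P (L * κ) (g * L)}
      one_mem' := ⟨LowerPattern.one, 1, LowerPattern.one, by
        rw [mul_one, one_mul]; exact PatternEquiv.refl _⟩
      mul_mem' := by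
        rintro κ κ' ⟨h, g, hg, hκ⟩ ⟨h', g', hg', hκ'⟩
        refine ⟨h.mul h', g * g', hg.mul hg', ?_⟩
        have h1 := hκ.mul_mul hP LowerPattern.one h'
        have h2 := hκ'.mul_mul hP hg LowerPattern.one
        simp only [one_mul, mul_one, ← mul_assoc] at h1 h2
        rw [← mul_assoc]
        exact h1.trans hP h2 }
  let KA : Submonoid (Matrix (Fin n) (Fin n) F) :=
    { carrier := {κ | LowerUnitri κ ∧ PatternEquiv P (κ * L) L}
      one_mem' := ⟨LowerPattern.one, by rw [one_mul]; exact PatternEquiv.refl _⟩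
      mul_mem' := by
        rintro κ κ' ⟨h, hκ⟩ ⟨h', hκ'⟩
        refine ⟨h.mul h', ?_⟩
        have h1 := hκ'.mul_mul hP h LowerPattern.one
        simp only [mul_one, ← mul_assoc] at h1
        exact h1.trans hP hκ }
  obtain ⟨B, κ, hB, hBT, ⟨-, g, hg, hκ⟩, rfl⟩ := hH.exists_eq_mul_left (rightFree P L) KB
    fun k l c hkl h => ⟨lowerUnitri_transvection hkl c, patternEquiv_mul_transvection hL h c⟩
  obtain ⟨A, κ', hA, hAT, ⟨-, hκ'⟩, hGA⟩ :=
    LowerUnitri.exists_eq_mul_right (hG.mul hg) (leftFree P L) KA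
    fun i j c hij h => ⟨lowerUnitri_transvection hij c, patternEquiv_transvection_mul hL h c⟩
  refine ⟨L, A, B, hL, hLP, hA, hAT, hB, hBT, hM.patternEquiv.trans hP ?_⟩
  have h1 := hκ.mul_mul hP hG hB
  have h2 := hκ'.mul_mul hP hA hB
  have e1 : G * (g * L) * B = A * (κ' * L) * B := by
    rw [← mul_assoc G, hGA, mul_assoc A]
  have e2 : G * (L * κ) * B = G * L * (κ * B) := by simp only [mul_assoc]
  rw [e1, e2] at h1
  exact h1.trans hP h2

/-- At a pivot of `L`, the product `G * L` has the same entry as `L`, so `L'` has a pivot in that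
row, weakly to the right; dually, a pivot of `L'` forces one of `L` in its column. Induction on
columns from the right makes the supports agree. -/
theorem IsPartialMonomial.eq_of_eqOnPositions {L L' G H : Matrix (Fin n) (Fin n) F}
    (hL : IsPartialMonomial L) (hL' : IsPartialMonomial L')
    (hLP : ∀ i k, L i k ≠ 0 → (i, k) ∈ P.carrier) (hLP' : ∀ i k, L' i k ≠ 0 → (i, k) ∈ P.carrier)
    (hG : LowerUnitri G) (hH : LowerUnitri H) (h : EqOnPositions P (G * L) (L' * H)) : L = L' := by
  have h1 : ∀ i k, L i k ≠ 0 → ∃ l, k ≤ l ∧ L' i l ≠ 0 := by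
    intro i k hik
    have e := h i k (hLP i k hik)
    rw [hL.mul_apply_left hik, hG.1, one_mul] at e
    rw [e, mul_apply] at hik
    obtain ⟨l, -, hl⟩ := Finset.exists_ne_zero_of_sum_ne_zero hik
    exact ⟨l, hH.le (right_ne_zero_of_mul hl), left_ne_zero_of_mul hl⟩
  have h2 : ∀ i l, L' i l ≠ 0 → ∃ j, j ≤ i ∧ L j l ≠ 0 := by
    intro i l hil
    have e := h i l (hLP' i l hil)
    rw [hL'.mul_apply_right hil, hH.1, mul_one] at e
    rw [← e, mul_apply] at hil
    obtain ⟨j, -, hj⟩ := Finset.exists_ne_zero_of_sum_ne_zero hil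
    exact ⟨j, hG.le (left_ne_zero_of_mul hj), right_ne_zero_of_mul hj⟩
  have h3 : ∀ k i, L i k ≠ 0 → L' i k ≠ 0 := by
    intro k
    induction k using WellFoundedGT.induction with
    | ind k ih =>
      intro i hik
      obtain ⟨l, hkl, hil⟩ := h1 i k hik
      rcases hkl.eq_or_lt with rfl | hkl
      · exact hil
      · obtain ⟨j, -, hjl⟩ := h2 i l hil
        have hij := hL'.row_eq hil (ih l hkl j hjl)
        subst hij
        exact absurd (hL.col_eq hik hjl) hkl.ne
  ext i k
  by_cases hik : L i k = 0
  · rw [hik]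
    by_contra hc
    obtain ⟨j, -, hj⟩ := h2 i k (Ne.symm hc)
    rw [hL'.row_eq (h3 k j hj) (Ne.symm hc)] at hj
    exact hj hik
  · have e := h i k (hLP i k hik)
    rwa [hL.mul_apply_left hik, hL'.mul_apply_right (h3 k i hik), hG.1, hH.1, one_mul,
      mul_one] at e

/-- First `M = 1`, column by column from the right, then `N = 1`, row by row from the top. By
induction, an off-diagonal entry of `M` is a difference of entries of `B'` and `B`, hence zero off
`rightFree`; on `rightFree` the hypothesis at a suitable position of `P` kills it. The rows of `N`
are treated in the same way. -/
theorem eq_of_eqOnPositions_of_free {L A A' B B' N M C D : Matrix (Fin n) (Fin n) F}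
    (hP : P.IsNormal) (hL : IsPartialMonomial L)
    (hAT : ∀ i j, i < j → A j i ≠ 0 → (j, i) ∈ leftFree P L)
    (hA' : LowerUnitri A') (hAT' : ∀ i j, i < j → A' j i ≠ 0 → (j, i) ∈ leftFree P L)
    (hB : LowerUnitri B) (hBT : ∀ k l, k < l → B l k ≠ 0 → (l, k) ∈ rightFree P L)
    (hBT' : ∀ k l, k < l → B' l k ≠ 0 → (l, k) ∈ rightFree P L)
    (hN : LowerUnitri N) (hM : LowerUnitri M) (hC : LowerPattern P C) (hD : LowerPattern P D)
    (hAN : A = A' * N) (hMB : B' = M * B) (h : EqOnPositions P (N * C * L) (L * (M * D))) :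
    A = A' ∧ B = B' := by
  have hM1 : ∀ k l, M l k = (1 : Matrix (Fin n) (Fin n) F) l k := by
    intro k
    induction k using WellFoundedGT.induction with
    | ind k ih =>
      intro l
      rcases lt_trichotomy l k with hlk | rfl | hkl
      · rw [hM.eq_zero hlk, one_apply_ne hlk.ne]
      · rw [hM.1, one_apply_eq]
      · rw [one_apply_ne hkl.ne']
        have e : B' l k = M l k + B l k := by
          have hterm : ∀ x, M l x * B x k = (if x = k then M l k else 0) +
              (if x = l then B l k else 0) := by
            intro x
            rcases lt_trichotomy x k with hx | rfl | hx
            · rw [hB.eq_zero hx, if_neg hx.ne, if_neg (hx.trans hkl).ne, mul_zero, add_zero]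
            · rw [hB.1, if_pos rfl, if_neg hkl.ne, mul_one, add_zero]
            · rw [ih x hx l, if_neg hx.ne', zero_add, one_apply]
              by_cases hxl : x = l
              · rw [if_pos hxl.symm, if_pos hxl, one_mul, hxl]
              · rw [if_neg (Ne.symm hxl), if_neg hxl, zero_mul]
          rw [hMB, mul_apply]
          simp only [hterm, Finset.sum_add_distrib, Finset.sum_ite_eq', Finset.mem_univ, if_true]
        by_cases hfree : (l, k) ∈ rightFree P L
        · obtain ⟨j, hjl, hklP, hjk, hz⟩ := hfree
          -- On the right only `L j l * M l k` remains, as `D` cannot alter `M` at a position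
          -- outside the transpose of `P`. On the left every term vanishes by freeness, by the pivot
          -- in row `j`, or by triangularity.
          have e1 := h j k hjk
          rw [hL.mul_apply_right hjl, hD.mul_apply_of_notMem hP hM hklP, mul_apply,
            Finset.sum_eq_zero] at e1
          · exact (mul_eq_zero.1 e1.symm).resolve_left hjl
          · intro i _
            rcases lt_trichotomy i j with hij | rfl | hij
            · rw [hz i hij, mul_zero]
            · have : L i k = 0 := by
                by_contra hc
                exact hkl.ne (hL.col_eq hc hjl)
              rw [this, mul_zero]
            · rw [LowerUnitri.eq_zero (hN.mul hC.full) hij, zero_mul]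
        · have e1 : B l k = 0 := by
            by_contra hc
            exact hfree (hBT k l hkl hc)
          have e2 : B' l k = 0 := by
            by_contra hc
            exact hfree (hBT' k l hkl hc)
          rw [e1, e2, add_zero] at e
          exact e.symm
  have hM1' : M = 1 := by
    ext l k
    exact hM1 k l
  subst hM1'
  rw [one_mul] at hMB h
  refine ⟨?_, hMB.symm⟩
  have hN1 : ∀ j i, N j i = (1 : Matrix (Fin n) (Fin n) F) j i := by
    intro j
    induction j using WellFoundedLT.induction with
    | ind j ih =>
      intro i
      rcases lt_trichotomy j i with hji | rfl | hij
      · rw [hN.eq_zero hji, one_apply_ne hji.ne]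
      · rw [hN.1, one_apply_eq]
      · rw [one_apply_ne hij.ne']
        have e : A j i = N j i + A' j i := by
          have hterm : ∀ x, A' j x * N x i = (if x = j then N j i else 0) +
              (if x = i then A' j i else 0) := by
            intro x
            rcases lt_trichotomy x j with hx | rfl | hx
            · rw [ih x hx i, if_neg hx.ne, zero_add, one_apply]
              by_cases hxi : x = i
              · rw [if_pos hxi, if_pos hxi, mul_one, hxi]
              · rw [if_neg hxi, if_neg hxi, mul_zero]
            · rw [hA'.1, if_pos rfl, if_neg hij.ne', one_mul, add_zero]
            · rw [hA'.eq_zero hx, if_neg hx.ne', if_neg (hij.trans hx).ne', zero_mul, add_zero]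
          rw [hAN, mul_apply]
          simp only [hterm, Finset.sum_add_distrib, Finset.sum_ite_eq', Finset.mem_univ, if_true]
        by_cases hfree : (j, i) ∈ leftFree P L
        · obtain ⟨k, hik, hijP, hjk, hz⟩ := hfree
          have e1 := h j k hjk
          rw [hL.mul_apply_left hik, hC.mul_apply_of_notMem hP hN hijP, mul_apply,
            Finset.sum_eq_zero] at e1
          · exact (mul_eq_zero.1 e1).resolve_right hik
          · intro l _
            by_cases hjl : L j l = 0
            · rw [hjl, zero_mul]
            · have hlk : l ≠ k := by
                rintro rfl
                exact hij.ne (hL.row_eq hik hjl)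
              have : D l k = 0 := by
                by_contra hc
                exact hz l hjl (hD.2 k l hlk hc)
              rw [this, mul_zero]
        · have e1 : A j i = 0 := by
            by_contra hc
            exact hfree (hAT i j hij hc)
          have e2 : A' j i = 0 := by
            by_contra hc
            exact hfree (hAT' i j hij hc)
          rw [e1, e2, add_zero] at e
          exact e.symm
  have hN1' : N = 1 := by
    ext j i
    exact hN1 j i
  rw [hAN, hN1', mul_one]

theorem PatternEquiv.normalForm_unique [Finite F] {L L' A A' B B' : Matrix (Fin n) (Fin n) F}
    (hP : P.IsNormal) (hL : IsPartialMonomial L) (hL' : IsPartialMonomial L')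
    (hLP : ∀ i k, L i k ≠ 0 → (i, k) ∈ P.carrier) (hLP' : ∀ i k, L' i k ≠ 0 → (i, k) ∈ P.carrier)
    (hA : LowerUnitri A) (hAT : ∀ i j, i < j → A j i ≠ 0 → (j, i) ∈ leftFree P L)
    (hA' : LowerUnitri A') (hAT' : ∀ i j, i < j → A' j i ≠ 0 → (j, i) ∈ leftFree P L')
    (hB : LowerUnitri B) (hBT : ∀ k l, k < l → B l k ≠ 0 → (l, k) ∈ rightFree P L)
    (hB' : LowerUnitri B') (hBT' : ∀ k l, k < l → B' l k ≠ 0 → (l, k) ∈ rightFree P L')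
    (h : PatternEquiv P (A * L * B) (A' * L' * B')) : L = L' ∧ A = A' ∧ B = B' := by
  obtain ⟨C, D, hC, hD, h⟩ := h
  obtain ⟨C', hC', hCA⟩ := hC.mul_eq_mul_right hP hA
  obtain ⟨D', hD', hBD⟩ := hD.mul_eq_mul_left hP hB
  obtain ⟨D'', hD'', hDD, -⟩ := hD'.exists_inv
  obtain ⟨A₁, hA₁, hAA, hAA'⟩ := hA'.exists_inv
  obtain ⟨B₁, hB₁, hBB, hBB'⟩ := hB.exists_inv
  -- Normality moves the pattern factors inside past `A` and `B`; cancelling `A'` on the left and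
  -- `B` on the right leaves one unitriangular factor beside each of `L` and `L'`.
  have h' := h.mul_mul hP hA₁ (hB₁.mul hD''.full)
  have e1 : A₁ * (C * (A * L * B) * D) * (B₁ * D'') = A₁ * A * C' * L := by
    calc A₁ * (C * (A * L * B) * D) * (B₁ * D'')
        = A₁ * (C * A) * L * (B * D) * (B₁ * D'') := by simp only [mul_assoc]
      _ = A₁ * A * C' * L * (D' * (B * B₁) * D'') := by rw [hCA, hBD]; simp only [mul_assoc]
      _ = A₁ * A * C' * L := by rw [hBB, mul_one, hDD, mul_one]
  have e2 : A₁ * (A' * L' * B') * (B₁ * D'') = L' * (B' * B₁ * D'') := by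
    calc A₁ * (A' * L' * B') * (B₁ * D'') = A₁ * A' * L' * (B' * B₁ * D'') := by
          simp only [mul_assoc]
      _ = L' * (B' * B₁ * D'') := by rw [hAA', one_mul]
  rw [e1, e2] at h'
  have hLL := hL.eq_of_eqOnPositions hL' hLP hLP' ((hA₁.mul hA).mul hC'.full)
    ((hB'.mul hB₁).mul hD''.full) h'
  subst hLL
  exact ⟨rfl, eq_of_eqOnPositions_of_free hP hL hAT hA' hAT' hB hBT hBT' (hA₁.mul hA)
    (hB'.mul hB₁) hC' hD'' (by rw [← mul_assoc, hAA, one_mul]) (by rw [mul_assoc, hBB', mul_one])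
    h'⟩

end NormalForm

/-! ### Orbits of functionals and their supercharacters. -/

section Orbits

open Matrix

variable {n : ℕ} {F : Type*} [Field F] {P : PosetOn n}

/-- The matrix of entries of a functional on `𝔫_P`. -/
noncomputable def entryMatrix (lam : NilDual F P) : Matrix (Fin n) (Fin n) F :=
  fun i j => entry lam i j

theorem dualOfEntries_apply_eq_trace (A : Matrix (Fin n) (Fin n) F) (X : nilAlg F P) :
    dualOfEntries P A X = trace (Aᵀ * (X : Matrix (Fin n) (Fin n) F)) := by
  simp only [dualOfEntries, LinearMap.coe_mk, AddHom.coe_mk, trace, diag_apply, mul_apply,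
    transpose_apply]
  exact Finset.sum_comm

theorem dualOfEntries_entryMatrix (lam : NilDual F P) : dualOfEntries P (entryMatrix lam) = lam :=
  LinearMap.ext fun X => (apply_eq_sum_entry lam X).symm

theorem dualOfEntries_eq_iff (A : Matrix (Fin n) (Fin n) F) (lam : NilDual F P) :
    dualOfEntries P A = lam ↔ EqOnPositions P A (entryMatrix lam) := by
  constructor
  · rintro rfl i k hik
    exact (entry_dualOfEntries A hik).symm
  · intro h
    refine dual_ext_entry fun i k => ?_
    by_cases hik : (i, k) ∈ P.carrier
    · rw [entry_dualOfEntries A hik]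
      exact h i k hik
    · rw [entry_of_notMem _ hik, entry_of_notMem _ hik]

theorem EqOnPositions.symm {R : Type*} {X Y : Matrix (Fin n) (Fin n) R}
    (h : EqOnPositions P X Y) : EqOnPositions P Y X :=
  fun i k hik => (h i k hik).symm

/-- If `lam ≠ μ`, then `lam - μ` takes every value in `F`, so equality of the characters would make
`θ` trivial. -/
theorem compAddMonoidHom_dual_injective {V : Type*} [AddCommGroup V] [Module F V]
    {θ : AddChar F ℂ} (hθ : θ ≠ 1) : Function.Injective fun lam : Module.Dual F V =>
      θ.compAddMonoidHom lam.toAddMonoidHom := by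
  intro lam μ h
  by_contra hne
  refine hθ (DFunLike.ext _ _ fun c => ?_)
  obtain ⟨X, hX⟩ : ∃ X, lam X - μ X ≠ 0 := by
    by_contra! hc
    exact hne (LinearMap.ext fun X => sub_eq_zero.1 (hc X))
  have h1 := DFunLike.congr_fun h ((c / (lam X - μ X)) • X)
  simp only [AddChar.compAddMonoidHom_apply, LinearMap.toAddMonoidHom_coe, map_smul,
    smul_eq_mul] at h1
  have h2 : c = c / (lam X - μ X) * lam X - c / (lam X - μ X) * μ X := by
    field_simp
  rw [h2, AddChar.map_sub_eq_div, h1, AddChar.one_apply]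
  exact div_self (AddChar.val_isUnit θ _).ne_zero

variable [Finite F]

theorem rightAct_leftAct (g h : patternGroup F P) (lam : NilDual F P) :
    rightAct (leftAct g lam) h =
      dualOfEntries P ((((g⁻¹ : patternGroup F P) : GL (Fin n) F) : Matrix (Fin n) (Fin n) F)ᵀ *
        entryMatrix lam *
        (((h⁻¹ : patternGroup F P) : GL (Fin n) F) : Matrix (Fin n) (Fin n) F)ᵀ) := by
  ext X
  rw [dualOfEntries_apply_eq_trace]
  conv_lhs => rw [← dualOfEntries_entryMatrix lam]
  change dualOfEntries P (entryMatrix lam) (leftMul g⁻¹ (rightMul h⁻¹ X)) = _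
  rw [dualOfEntries_apply_eq_trace]
  change trace ((entryMatrix lam)ᵀ * (_ * (_ * _))) = _
  rw [transpose_mul, transpose_mul, transpose_transpose, transpose_transpose, mul_assoc _ _ X.1,
    trace_mul_comm (((h⁻¹ : patternGroup F P) : GL (Fin n) F) : Matrix (Fin n) (Fin n) F)]
  simp only [mul_assoc]

theorem mem_twoSidedOrbit_iff {lam μ : NilDual F P} :
    μ ∈ twoSidedOrbit lam ↔ PatternEquiv P (entryMatrix lam) (entryMatrix μ) := by
  constructor
  · rintro ⟨⟨g, h⟩, hgh⟩
    simp only at hgh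
    rw [rightAct_leftAct, dualOfEntries_eq_iff] at hgh
    exact ⟨_, _, lowerPattern_iff.2 (by rw [transpose_transpose]; exact g⁻¹.2),
      lowerPattern_iff.2 (by rw [transpose_transpose]; exact h⁻¹.2), hgh⟩
  · rintro ⟨A, B, hA, hB, h⟩
    obtain ⟨u, hu⟩ := (lowerPattern_iff.1 hA).exists_patternGroup
    obtain ⟨v, hv⟩ := (lowerPattern_iff.1 hB).exists_patternGroup
    refine ⟨(u⁻¹, v⁻¹), ?_⟩
    simp only
    rw [rightAct_leftAct, dualOfEntries_eq_iff, inv_inv, inv_inv, hu, hv, transpose_transpose,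
      transpose_transpose]
    exact h

theorem twoSidedOrbit_eq_of_mem (hP : P.IsNormal) {lam μ : NilDual F P}
    (h : μ ∈ twoSidedOrbit lam) : twoSidedOrbit μ = twoSidedOrbit lam := by
  rw [mem_twoSidedOrbit_iff] at h
  ext ν
  rw [mem_twoSidedOrbit_iff, mem_twoSidedOrbit_iff]
  exact ⟨fun h' => h.trans hP h', fun h' => (h.symm hP).trans hP h'⟩

theorem leftAct_mul (g h : patternGroup F P) (lam : NilDual F P) :
    leftAct (g * h) lam = leftAct g (leftAct h lam) := by
  ext X
  change lam _ = lam _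
  congr 1
  apply Subtype.ext
  change (((g * h)⁻¹ : patternGroup F P) : GL (Fin n) F).1 * X.1 =
    ((h⁻¹ : patternGroup F P) : GL (Fin n) F).1 *
      (((g⁻¹ : patternGroup F P) : GL (Fin n) F).1 * X.1)
  rw [← mul_assoc, ← Units.val_mul, ← Subgroup.coe_mul, _root_.mul_inv_rev]

theorem rightAct_inv_rightAct (lam : NilDual F P) (h : patternGroup F P) :
    rightAct (rightAct lam h) h⁻¹ = lam := by
  ext X
  change lam _ = lam _
  congr 1
  apply Subtype.ext
  change X.1 * ((h⁻¹⁻¹ : patternGroup F P) : GL (Fin n) F).1 *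
    ((h⁻¹ : patternGroup F P) : GL (Fin n) F).1 = X.1
  rw [mul_assoc, ← Units.val_mul, ← Subgroup.coe_mul, inv_mul_cancel]
  simp

theorem leftAct_rightAct (g h : patternGroup F P) (lam : NilDual F P) :
    leftAct g (rightAct lam h) = rightAct (leftAct g lam) h := by
  ext X
  change lam _ = lam _
  congr 1
  apply Subtype.ext
  exact mul_assoc _ _ _

theorem leftOrbit_leftAct (g : patternGroup F P) (lam : NilDual F P) :
    leftOrbit (leftAct g lam) = leftOrbit lam := by
  ext μ
  constructor
  · rintro ⟨h, rfl⟩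
    exact ⟨h * g, leftAct_mul h g lam⟩
  · rintro ⟨h, rfl⟩
    refine ⟨h * g⁻¹, ?_⟩
    simp only
    rw [← leftAct_mul, inv_mul_cancel_right]

theorem leftOrbit_rightAct (h : patternGroup F P) (lam : NilDual F P) :
    leftOrbit (rightAct lam h) = (fun μ => rightAct μ h) '' leftOrbit lam := by
  ext μ
  constructor
  · rintro ⟨g, rfl⟩
    exact ⟨_, ⟨g, rfl⟩, (leftAct_rightAct g h lam).symm⟩
  · rintro ⟨_, ⟨g, rfl⟩, rfl⟩
    exact ⟨g, leftAct_rightAct g h lam⟩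

/-- The two actions commute, so right translation maps one left orbit bijectively onto the other.
Hence the normalizing factor of a supercharacter depends only on the two-sided orbit. -/
theorem ncard_leftOrbit_eq_of_mem {lam μ : NilDual F P} (h : μ ∈ twoSidedOrbit lam) :
    (leftOrbit μ).ncard = (leftOrbit lam).ncard := by
  obtain ⟨⟨g, k⟩, rfl⟩ := h
  simp only
  rw [leftOrbit_rightAct, leftOrbit_leftAct]
  exact Set.ncard_image_of_injective _
    (Function.LeftInverse.injective (g := fun ν => rightAct ν k⁻¹)
      fun ν => rightAct_inv_rightAct ν k)

theorem superchar_eq_of_mem (hP : P.IsNormal) (θ : AddChar F ℂ) {lam μ : NilDual F P}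
    (h : μ ∈ twoSidedOrbit lam) : superchar θ μ = superchar θ lam := by
  funext g
  unfold superchar
  rw [ncard_leftOrbit_eq_of_mem h, twoSidedOrbit_eq_of_mem hP h]

theorem exists_subOne_eq (X : nilAlg F P) : ∃ g : patternGroup F P, subOne g = X := by
  have h : IsPatternMatrix P (1 + (X : Matrix (Fin n) (Fin n) F)) := by
    rw [isPatternMatrix_iff, add_sub_cancel_left]
    exact X.2
  obtain ⟨u, hu⟩ := h.exists_patternGroup
  refine ⟨u, Subtype.ext ?_⟩
  change ((u : GL (Fin n) F) : Matrix (Fin n) (Fin n) F) - 1 = X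
  rw [hu, add_sub_cancel_left]

instance NilDual.instFinite : Finite (NilDual F P) :=
  Module.finite_of_finite F

theorem mem_twoSidedOrbit_self (lam : NilDual F P) : lam ∈ twoSidedOrbit lam :=
  mem_twoSidedOrbit_iff.2 (PatternEquiv.refl _)

/-- As `g - 1` runs through all of `𝔫_P`, a supercharacter is a combination of distinct additive
characters of `𝔫_P`, with nonzero coefficients exactly on its orbit. Linear independence allows the
coefficients at `lam` to be compared. -/
theorem mem_twoSidedOrbit_of_superchar_eq {θ : AddChar F ℂ} (hθ : θ ≠ 1) {lam μ : NilDual F P}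
    (h : superchar θ lam = superchar θ μ) : lam ∈ twoSidedOrbit μ := by
  classical
  have : Fintype (NilDual F P) := Fintype.ofFinite _
  let coef : NilDual F P → NilDual F P → ℂ := fun κ ν => if ν ∈ twoSidedOrbit κ then
    ((leftOrbit κ).ncard : ℂ) / ((twoSidedOrbit κ).ncard : ℂ) else 0
  have hsum : ∀ (κ : NilDual F P) (g : patternGroup F P),
      superchar θ κ g = ∑ ν, coef κ ν * θ (ν (subOne g)) := by
    intro κ g
    unfold superchar
    rw [finsum_mem_def, finsum_eq_sum_of_fintype, Finset.mul_sum]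
    refine Finset.sum_congr rfl fun ν _ => ?_
    by_cases hν : ν ∈ twoSidedOrbit κ
    · simp [coef, hν]
    · simp [coef, hν]
  have : Finite (nilAlg F P) := inferInstance
  have hli : LinearIndependent ℂ fun ν : NilDual F P =>
      ((θ.compAddMonoidHom ν.toAddMonoidHom : AddChar (nilAlg F P) ℂ) : nilAlg F P → ℂ) :=
    (AddChar.linearIndependent (nilAlg F P) ℂ).comp _ (compAddMonoidHom_dual_injective hθ)
  have hzero := Fintype.linearIndependent_iff.1 hli (fun ν => coef lam ν - coef μ ν) (by
    funext X
    obtain ⟨g, rfl⟩ := exists_subOne_eq X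
    have := congrFun h g
    rw [hsum, hsum, ← sub_eq_zero, ← Finset.sum_sub_distrib] at this
    simpa [sub_mul] using this) lam
  by_contra hc
  have h1 : ((leftOrbit lam).ncard : ℂ) ≠ 0 := by
    rw [Nat.cast_ne_zero]
    exact Set.ncard_ne_zero_of_mem ⟨1, rfl⟩
  have h2 : ((twoSidedOrbit lam).ncard : ℂ) ≠ 0 := by
    rw [Nat.cast_ne_zero]
    exact Set.ncard_ne_zero_of_mem (mem_twoSidedOrbit_self lam)
  simp only [coef, if_pos (mem_twoSidedOrbit_self lam), if_neg hc, sub_zero] at hzero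
  exact div_ne_zero h1 h2 hzero

end Orbits

/-! ### Index pairs as normal forms. -/

section IndexPairs

open Matrix

variable {n : ℕ} {F : Type*} [Field F] {P : PosetOn n}

/-- The double sum in `ℜ^*` is the product `(A - 1) * L * (B - 1)` for `L = entryMatrix lam`. For a
pivot `(i, l)`, the entries of `η_L` and `η_{R∖L}` each contain a factor `λ_il`, and `λ_il⁻¹`
removes the duplicate. -/
theorem eqOnPositions_add_coRep {lam η : NilDual F P} (hlam : IsSetPartition lam)
    {A B : Matrix (Fin n) (Fin n) F} (hA : LowerUnitri A) (hB : LowerUnitri B)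
    (hAη : entryMatrix (restrictTo (coauxL lam) η) = (A - 1) * entryMatrix lam)
    (hBη : entryMatrix (restrictTo (coauxR lam \ coauxL lam) η) = entryMatrix lam * (B - 1)) :
    EqOnPositions P (entryMatrix (lam + coRep lam η)) (A * entryMatrix lam * B) := by
  have hL : IsPartialMonomial (entryMatrix lam) := hlam
  intro j k hjk
  have hlt : j < k := P.lt_of_mem hjk
  have e1 : A * entryMatrix lam * B = entryMatrix lam + ((A - 1) * entryMatrix lam +
      entryMatrix lam * (B - 1) + (A - 1) * (entryMatrix lam * (B - 1))) := by
    noncomm_ring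
  rw [e1, ← hAη, ← hBη, Matrix.add_apply, Matrix.add_apply, Matrix.add_apply, mul_apply]
  change entry (lam + coRep lam η) j k = _
  rw [entry_add, coRep, starProd, entry_dualOfEntries _ hjk]
  refine congrArg₂ (· + ·) rfl (congrArg₂ (· + ·) rfl (Finset.sum_congr rfl fun i _ => ?_))
  -- The inequalities in `starProd` cost nothing: triangularity makes the excluded terms vanish.
  have hA0 : ¬ i < j → (A - 1) j i = 0 := by
    intro h
    rw [Matrix.sub_apply]
    rcases (not_lt.1 h).eq_or_lt with rfl | h'
    · rw [hA.1, one_apply_eq, sub_self]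
    · rw [hA.eq_zero h', one_apply_ne h'.ne, sub_self]
  have hB0 : ∀ l, ¬ k < l → (B - 1) l k = 0 := by
    intro l h
    rw [Matrix.sub_apply]
    rcases (not_lt.1 h).eq_or_lt with rfl | h'
    · rw [hB.1, one_apply_eq, sub_self]
    · rw [hB.eq_zero h', one_apply_ne h'.ne, sub_self]
  by_cases hrow : ∃ l, entryMatrix lam i l ≠ 0
  · obtain ⟨l, hl⟩ := hrow
    rw [Finset.sum_eq_single l]
    · have h1 : entry (restrictTo (coauxL lam) η) j l = (A - 1) j i * entryMatrix lam i l := by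
        rw [← hL.mul_apply_left hl, ← hAη]
        rfl
      have h2 : entry (restrictTo (coauxR lam \ coauxL lam) η) i k =
          entryMatrix lam i l * (B - 1) l k := by
        rw [← hL.mul_apply_right hl, ← hBη]
        rfl
      have h3 : entryMatrix (restrictTo (coauxR lam \ coauxL lam) η) i k =
          entryMatrix lam i l * (B - 1) l k := h2
      rw [h1, h2, h3]
      by_cases hij : i < j
      · by_cases hkl : k < l
        · rw [if_pos ⟨hij, hlt, hkl, hl⟩]
          change _ * (entryMatrix lam i l)⁻¹ = _
          field_simp
        · rw [if_neg fun h => hkl h.2.2.1, hB0 l hkl, mul_zero, mul_zero]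
      · rw [if_neg fun h => hij h.1, hA0 hij, zero_mul]
    · intro l' _ hl'
      exact if_neg fun h => hl' (hL.col_eq h.2.2.2 hl)
    · simp
  · push Not at hrow
    rw [Finset.sum_eq_zero fun l _ => if_neg fun h => h.2.2.2 (hrow l), hBη, mul_apply,
      Finset.sum_eq_zero fun l _ => by rw [hrow l, zero_mul], mul_zero]

namespace IndexPair

theorem isPartialMonomial (p : IndexPair F P) : IsPartialMonomial (entryMatrix p.lam) :=
  p.isSetPartition

theorem entry_eta_eq_add (p : IndexPair F P) (i j : Fin n) :
    entry p.eta i j = entry (restrictTo (coauxL p.lam) p.eta) i j +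
      entry (restrictTo (coauxR p.lam \ coauxL p.lam) p.eta) i j := by
  classical
  rw [entry_restrictTo, entry_restrictTo]
  by_cases h : entry p.eta i j = 0
  · simp [h]
  · have hmem : (i, j) ∈ coaux p.lam := p.supp_eta h
    by_cases hl : (i, j) ∈ coauxL p.lam
    · simp [hl]
    · have hr : (i, j) ∈ coauxR p.lam := by
        rcases hmem.1 with h' | h'
        · exact absurd ⟨h', fun h'' => hmem.2 (Or.inl h'')⟩ hl
        · exact ⟨h', fun h'' => hmem.2 (Or.inr h'')⟩
      simp [hl, hr]

/-- A pivot `(i, k)` matches the position `(j, i)` of `leftFree` with the position `(j, k)` of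
`coauxL` in `coaux`; dividing by the pivot turns `η_L` into `A - 1`. -/
theorem exists_left_factor (p : IndexPair F P) : ∃ A : Matrix (Fin n) (Fin n) F,
    LowerUnitri A ∧ (∀ i j, i < j → A j i ≠ 0 → (j, i) ∈ leftFree P (entryMatrix p.lam)) ∧
    entryMatrix (restrictTo (coauxL p.lam) p.eta) = (A - 1) * entryMatrix p.lam := by
  classical
  have hL := p.isPartialMonomial
  set L := entryMatrix p.lam
  set E := entryMatrix (restrictTo (coauxL p.lam) p.eta)
  have hE : ∀ j k, E j k ≠ 0 → (j, k) ∈ coauxL p.lam ∧ (j, k) ∈ coaux p.lam := by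
    intro j k h
    change entry _ j k ≠ 0 at h
    rw [entry_restrictTo] at h
    split_ifs at h with h'
    · exact ⟨h', p.supp_eta h⟩
    · exact absurd rfl h
  -- At most one term is nonzero: since `0⁻¹ = 0`, only a pivot in row `i` contributes.
  set a : Matrix (Fin n) (Fin n) F := fun j i => ∑ k, E j k * (L i k)⁻¹
  have ha : ∀ j i k, L i k ≠ 0 → a j i = E j k * (L i k)⁻¹ := by
    intro j i k hik
    refine Finset.sum_eq_single k (fun k' _ hk' => ?_) (by simp)
    have : L i k' = 0 := by
      by_contra hc
      exact hk' (hL.col_eq hc hik)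
    rw [this, _root_.inv_zero, mul_zero]
  have hfree : ∀ j i, a j i ≠ 0 → i < j ∧ (j, i) ∈ leftFree P L := by
    intro j i h
    obtain ⟨k, -, hk⟩ := Finset.exists_ne_zero_of_sum_ne_zero h
    have hik : L i k ≠ 0 := fun h0 => hk (by rw [h0, _root_.inv_zero, mul_zero])
    obtain ⟨h1, h2⟩ := hE j k (left_ne_zero_of_mul hk)
    obtain ⟨hjk, i', hi', hij⟩ := h1.1
    have hii : i' = i := hL.row_eq hi' hik
    subst hii
    exact ⟨hij, k, hik, fun h => h2.2 (Or.inl ⟨hjk, i', hi', h⟩), hjk,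
      fun l hl h => h2.2 (Or.inr ⟨hjk, l, hl, h⟩)⟩
  refine ⟨1 + a, ⟨fun i => ?_, fun i j hij h => ?_⟩, fun i j hij h => ?_, ?_⟩
  · have : a i i = 0 := by
      by_contra hc
      exact lt_irrefl i (hfree i i hc).1
    rw [Matrix.add_apply, one_apply_eq, this, add_zero]
  · rw [Matrix.add_apply, one_apply_ne hij, zero_add] at h
    exact (hfree j i h).1
  · rw [Matrix.add_apply, one_apply_ne hij.ne', zero_add] at h
    exact (hfree j i h).2
  · rw [add_sub_cancel_left]
    ext j k
    by_cases hcol : ∃ i, L i k ≠ 0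
    · obtain ⟨i, hik⟩ := hcol
      rw [hL.mul_apply_left hik, ha j i k hik]
      field_simp
    · push Not at hcol
      rw [mul_apply, Finset.sum_eq_zero fun i _ => by rw [hcol i, mul_zero]]
      by_contra hc
      obtain ⟨_, i, hi, -⟩ := (hE j k hc).1.1
      exact hi (hcol i)

theorem exists_right_factor (p : IndexPair F P) : ∃ B : Matrix (Fin n) (Fin n) F,
    LowerUnitri B ∧ (∀ k l, k < l → B l k ≠ 0 → (l, k) ∈ rightFree P (entryMatrix p.lam)) ∧
    entryMatrix (restrictTo (coauxR p.lam \ coauxL p.lam) p.eta) =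
      entryMatrix p.lam * (B - 1) := by
  classical
  have hL := p.isPartialMonomial
  set L := entryMatrix p.lam
  set E := entryMatrix (restrictTo (coauxR p.lam \ coauxL p.lam) p.eta)
  have hE : ∀ j k, E j k ≠ 0 → (j, k) ∈ coauxR p.lam \ coauxL p.lam ∧ (j, k) ∈ coaux p.lam := by
    intro j k h
    change entry _ j k ≠ 0 at h
    rw [entry_restrictTo] at h
    split_ifs at h with h'
    · exact ⟨h', p.supp_eta h⟩
    · exact absurd rfl h
  set b : Matrix (Fin n) (Fin n) F := fun l k => ∑ j, (L j l)⁻¹ * E j k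
  have hb : ∀ l k j, L j l ≠ 0 → b l k = (L j l)⁻¹ * E j k := by
    intro l k j hjl
    refine Finset.sum_eq_single j (fun j' _ hj' => ?_) (by simp)
    have : L j' l = 0 := by
      by_contra hc
      exact hj' (hL.row_eq hc hjl)
    rw [this, _root_.inv_zero, zero_mul]
  have hfree : ∀ l k, b l k ≠ 0 → k < l ∧ (l, k) ∈ rightFree P L := by
    intro l k h
    obtain ⟨j, -, hj⟩ := Finset.exists_ne_zero_of_sum_ne_zero h
    have hjl : L j l ≠ 0 := fun h0 => hj (by rw [h0, _root_.inv_zero, zero_mul])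
    obtain ⟨h1, h2⟩ := hE j k (right_ne_zero_of_mul hj)
    obtain ⟨hjk, l', hl', hkl⟩ := h1.1.1
    have hll : l' = l := hL.col_eq hl' hjl
    subst hll
    refine ⟨hkl, j, hjl, fun h => h2.2 (Or.inr ⟨hjk, l', hl', h⟩), hjk, fun i hij => ?_⟩
    by_contra hc
    -- Outside `coauxL` but inside `coaux`, the position cannot lie below a pivot of its column, as
    -- `rightFree` demands.
    exact h1.2 ⟨⟨hjk, i, hc, hij⟩, fun h => h2.2 (Or.inl h)⟩
  refine ⟨1 + b, ⟨fun i => ?_, fun i j hij h => ?_⟩, fun i j hij h => ?_, ?_⟩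
  · have : b i i = 0 := by
      by_contra hc
      exact lt_irrefl i (hfree i i hc).1
    rw [Matrix.add_apply, one_apply_eq, this, add_zero]
  · rw [Matrix.add_apply, one_apply_ne hij, zero_add] at h
    exact (hfree j i h).1
  · rw [Matrix.add_apply, one_apply_ne hij.ne', zero_add] at h
    exact (hfree j i h).2
  · rw [add_sub_cancel_left]
    ext j k
    by_cases hrow : ∃ l, L j l ≠ 0
    · obtain ⟨l, hjl⟩ := hrow
      rw [hL.mul_apply_right hjl, hb l k j hjl]
      field_simp
    · push Not at hrow
      rw [mul_apply, Finset.sum_eq_zero fun l _ => by rw [hrow l, zero_mul]]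
      by_contra hc
      obtain ⟨_, l, hl, -⟩ := (hE j k hc).1.1.1
      exact hl (hrow l)

theorem exists_of_factors {L A B : Matrix (Fin n) (Fin n) F} (hL : IsPartialMonomial L)
    (hLP : ∀ i k, L i k ≠ 0 → (i, k) ∈ P.carrier) (hA : LowerUnitri A)
    (hAT : ∀ i j, i < j → A j i ≠ 0 → (j, i) ∈ leftFree P L) (hB : LowerUnitri B)
    (hBT : ∀ k l, k < l → B l k ≠ 0 → (l, k) ∈ rightFree P L) :
    ∃ p : IndexPair F P, entryMatrix p.lam = L ∧
      entryMatrix (restrictTo (coauxL p.lam) p.eta) = (A - 1) * L ∧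
      entryMatrix (restrictTo (coauxR p.lam \ coauxL p.lam) p.eta) = L * (B - 1) := by
  classical
  set lam : NilDual F P := dualOfEntries P L with hlam
  have hlamL : entryMatrix lam = L := by
    ext i k
    exact entry_dualOfEntries_of_support hLP i k
  have hsupp : ∀ i k, (i, k) ∈ dualSupp lam ↔ L i k ≠ 0 := by
    intro i k
    rw [← hlamL]
    exact Iff.rfl
  have hleft : ∀ j k, ((A - 1) * L) j k ≠ 0 → (j, k) ∈ P.carrier ∧ (j, k) ∈ coauxL lam ∧
      (j, k) ∈ coaux lam := by
    intro j k h
    rw [mul_apply] at h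
    obtain ⟨i, -, hi⟩ := Finset.exists_ne_zero_of_sum_ne_zero h
    have hik : L i k ≠ 0 := right_ne_zero_of_mul hi
    have ha : (A - 1) j i ≠ 0 := left_ne_zero_of_mul hi
    have hne : j ≠ i := by
      rintro rfl
      exact ha (by rw [Matrix.sub_apply, hA.1, one_apply_eq, sub_self])
    rw [Matrix.sub_apply, one_apply_ne hne, sub_zero] at ha
    have hij : i < j := lt_of_le_of_ne (hA.le ha) hne.symm
    obtain ⟨k', hk', hijP, hjk, hz⟩ := hAT i j hij ha
    have hkk : k' = k := hL.col_eq hk' hik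
    subst hkk
    have h1 : (j, k') ∈ coadjL (PosetOn.full n) lam := ⟨hjk, i, (hsupp _ _).2 hik, hij⟩
    have h2 : (j, k') ∉ coadjL P lam := by
      rintro ⟨-, i', hi', hi'j⟩
      rw [hsupp] at hi'
      have hii : i' = i := hL.row_eq hi' hik
      subst hii
      exact hijP hi'j
    refine ⟨hjk, ⟨h1, h2⟩, Or.inl h1, ?_⟩
    rintro (h' | ⟨-, l, hl, hkl⟩)
    · exact h2 h'
    · exact hz l ((hsupp _ _).1 hl) hkl
  have hright : ∀ j k, (L * (B - 1)) j k ≠ 0 → (j, k) ∈ P.carrier ∧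
      (j, k) ∈ coauxR lam \ coauxL lam ∧ (j, k) ∈ coaux lam := by
    intro j k h
    rw [mul_apply] at h
    obtain ⟨l, -, hl⟩ := Finset.exists_ne_zero_of_sum_ne_zero h
    have hjl : L j l ≠ 0 := left_ne_zero_of_mul hl
    have hb : (B - 1) l k ≠ 0 := right_ne_zero_of_mul hl
    have hne : l ≠ k := by
      rintro rfl
      exact hb (by rw [Matrix.sub_apply, hB.1, one_apply_eq, sub_self])
    rw [Matrix.sub_apply, one_apply_ne hne, sub_zero] at hb
    have hkl : k < l := lt_of_le_of_ne (hB.le hb) hne.symm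
    obtain ⟨j', hj', hklP, hjk, hz⟩ := hBT k l hkl hb
    have hjj : j' = j := hL.row_eq hj' hjl
    subst hjj
    have h1 : (j', k) ∈ coadjR (PosetOn.full n) lam := ⟨hjk, l, (hsupp _ _).2 hjl, hkl⟩
    have h2 : (j', k) ∉ coadjR P lam := by
      rintro ⟨-, l', hl', hkl'⟩
      rw [hsupp] at hl'
      have hll : l' = l := hL.col_eq hl' hjl
      subst hll
      exact hklP hkl'
    refine ⟨hjk, ⟨⟨h1, h2⟩, ?_⟩, Or.inr h1, ?_⟩
    · rintro ⟨⟨-, i, hi, hij⟩, -⟩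
      exact (hsupp _ _).1 hi (hz i hij)
    · rintro (⟨-, i, hi, hij⟩ | h')
      · exact (hsupp _ _).1 hi (hz i (P.lt_of_mem hij))
      · exact h2 h'
  set X := (A - 1) * L with hX
  set Y := L * (B - 1) with hY
  have hXY : ∀ j k, (X + Y) j k ≠ 0 → X j k ≠ 0 ∨ Y j k ≠ 0 := by
    intro j k h
    by_contra! hc
    exact h (by rw [Matrix.add_apply, hc.1, hc.2, add_zero])
  have heta : ∀ j k, entry (dualOfEntries P (X + Y)) j k = X j k + Y j k := fun j k =>
    entry_dualOfEntries_of_support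
      (fun i k h => (hXY i k h).elim (fun h => (hleft i k h).1) fun h => (hright i k h).1) j k
  refine ⟨⟨lam, dualOfEntries P (X + Y), ?_, ?_⟩, hlamL, ?_, ?_⟩
  · have : IsPartialMonomial (entryMatrix lam) := by rwa [hlamL]
    exact this
  · rintro ⟨j, k⟩ h
    change entry _ j k ≠ 0 at h
    rw [heta] at h
    exact (hXY j k h).elim (fun h => (hleft j k h).2.2) fun h => (hright j k h).2.2
  · ext j k
    change entry _ j k = _
    simp only [entry_restrictTo, heta]
    by_cases h : (j, k) ∈ coauxL lam
    · have : Y j k = 0 := by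
        by_contra hc
        exact (hright j k hc).2.1.2 h
      rw [if_pos h, this, add_zero]
    · rw [if_neg h]
      by_contra hc
      exact h (hleft j k (Ne.symm hc)).2.1
  · ext j k
    change entry _ j k = _
    simp only [entry_restrictTo, heta]
    by_cases h : (j, k) ∈ coauxR lam \ coauxL lam
    · have : X j k = 0 := by
        by_contra hc
        exact h.2 (hleft j k hc).2.1
      rw [if_pos h, this, zero_add]
    · rw [if_neg h]
      by_contra hc
      exact h (hright j k (Ne.symm hc)).2.1

theorem superchar_injective [Finite F] (hP : P.IsNormal) {θ : AddChar F ℂ} (hθ : θ ≠ 1) :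
    Function.Injective fun p : IndexPair F P => p.superchar θ := by
  intro p q h
  have h' := mem_twoSidedOrbit_iff.1
    (mem_twoSidedOrbit_of_superchar_eq hθ (Subtype.ext_iff.1 h).symm)
  obtain ⟨A, hA, hAT, hAη⟩ := p.exists_left_factor
  obtain ⟨B, hB, hBT, hBη⟩ := p.exists_right_factor
  obtain ⟨A', hA', hAT', hAη'⟩ := q.exists_left_factor
  obtain ⟨B', hB', hBT', hBη'⟩ := q.exists_right_factor
  have h1 := eqOnPositions_add_coRep p.isSetPartition hA hB hAη hBη
  have h2 := eqOnPositions_add_coRep q.isSetPartition hA' hB' hAη' hBη'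
  obtain ⟨hL, rfl, rfl⟩ := PatternEquiv.normalForm_unique hP p.isPartialMonomial
    q.isPartialMonomial (fun i k h => dualSupp_subset p.lam h)
    (fun i k h => dualSupp_subset q.lam h) hA hAT hA' hAT' hB hBT hB' hBT'
    ((h1.symm.patternEquiv.trans hP h').trans hP h2.patternEquiv)
  have hlam : p.lam = q.lam := by
    rw [← dualOfEntries_entryMatrix p.lam, hL, dualOfEntries_entryMatrix]
  refine IndexPair.ext hlam (dual_ext_entry fun i j => ?_)
  rw [p.entry_eta_eq_add, q.entry_eta_eq_add]
  have e1 := hAη.trans ((congrArg _ hL).trans hAη'.symm)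
  have e2 := hBη.trans ((congrArg (· * (B - 1)) hL).trans hBη'.symm)
  exact congrArg₂ (· + ·) (congrFun (congrFun e1 i) j) (congrFun (congrFun e2 i) j)

theorem superchar_surjective [Finite F] (hP : P.IsNormal) (θ : AddChar F ℂ) :
    Function.Surjective fun p : IndexPair F P => p.superchar θ := by
  rintro ⟨_, μ, rfl⟩
  obtain ⟨L, A, B, hL, hLP, hA, hAT, hB, hBT, h⟩ :=
    exists_patternEquiv_normalForm hP (entryMatrix μ)
  obtain ⟨p, rfl, hAη, hBη⟩ := exists_of_factors hL hLP hA hAT hB hBT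
  refine ⟨p, Subtype.ext (superchar_eq_of_mem hP θ (mem_twoSidedOrbit_iff.2 ?_))⟩
  exact h.trans hP
    (eqOnPositions_add_coRep p.isSetPartition hA hB hAη hBη).symm.patternEquiv

end IndexPair

end IndexPairs

theorem mainTheorem3 {F : Type*} [Field F] [Finite F] {n : ℕ} (P : PosetOn n) (hP : P.IsNormal)
    (θ : AddChar F ℂ) (hθ : θ ≠ 1) :
    -- every poset on `[n]` has a unique highest cover set
    (∀ Q : PosetOn n, ∃! S : Finset (Fin n × Fin n), Q.IsHighestCoverSet S) ∧
    -- the covers of `P^{(λ,η)}` are the positions in `supp(λ + η)`, labeled by `λ + η`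
    (∀ p : IndexPair F P, (p.toLabeledPoset hP).covers = dualSupp (p.lam + p.eta) ∧
      ∀ i j, (p.toLabeledPoset hP).label i j = entry (p.lam + p.eta) i j) ∧
    -- `χ^{(λ,η)} ↦ (λ,η)` and `(λ,η) ↦ P^{(λ,η)}` are well-defined bijections, and so is their
    -- composite
    ∃ (f : supercharacters P θ → IndexPair F P)
      (g : IndexPair F P → {Q : LabeledPoset n F // P.IsRepresentative Q.toPosetOn}),
      (∀ p : IndexPair F P, f (p.superchar θ) = p) ∧ Function.Bijective f ∧
      (∀ p : IndexPair F P, (g p : LabeledPoset n F) = p.toLabeledPoset hP) ∧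
      Function.Bijective g ∧ Function.Bijective (g ∘ f) := by
  -- The map from supercharacters to index pairs is obtained as the inverse of this bijection, which
  -- gives its well-definedness.
  let e := Equiv.ofBijective (fun p : IndexPair F P => p.superchar θ)
    ⟨IndexPair.superchar_injective hP hθ, IndexPair.superchar_surjective hP θ⟩
  let g : IndexPair F P → {Q : LabeledPoset n F // P.IsRepresentative Q.toPosetOn} :=
    fun p => ⟨p.toLabeledPoset hP, p.isRepresentative hP⟩
  have hg : Function.Bijective g := by
    refine ⟨fun p q h => IndexPair.toLabeledPoset_injective hP (Subtype.ext_iff.1 h), ?_⟩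
    rintro ⟨Q, hQ⟩
    obtain ⟨p, hp⟩ := IndexPair.exists_toLabeledPoset_eq hP Q hQ
    exact ⟨p, Subtype.ext hp⟩
  exact ⟨PosetOn.existsUnique_isHighestCoverSet,
    fun p => ⟨p.covers_toLabeledPoset hP, fun i j => rfl⟩,
    e.symm, g, fun p => e.symm_apply_apply p, e.symm.bijective, fun p => rfl, hg,
    hg.comp e.symm.bijective⟩
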